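/- Let $d \ge 1$ and $\lambda = (2,2,\ldots,2)$ ($d$ parts). Let $$\widetilde{\mathcal P}_{d+1}(\lambda) = \operatorname{conv}\{(x,\, x_1^2+\cdots+x_d^2) : x \in \mathbb Z^d,\ 0 \le x_i \le 2 \text{ for } 1 \le i \le d\} \subset \mathbb R^{d+1},$$ the lifted pile of cubes corresponding to $\lambda$, and let $\pi : \widetilde{\mathcal P}_{d+1}(\lambda) \to Q = [0,2d]$ be the projection $\pi(x) = x_1 + \cdots + x_d$ (the sum of the first $d$ coordinates). Let $$\Pi_d(\lambda) = \Big\{ \tfrac{1}{\operatorname{vol}(Q)} \int_Q \gamma(t)\, dt \ :\ \gamma \text{ is a section of } \pi \Big\} \subset \mathbb R^{d+1}$$ be the monotone path polytope of $\pi$, where a section of $\pi$ is a continuous map $\gamma : Q \to \widetilde{\mathcal P}_{d+1}(\lambda)$ with $\pi(\gamma(t)) = t$ for all $t \in Q$. A lower face of a polytope in $\mathbb R^{d+1}$ is a nonempty face on which some linear functional $c(x) = a_1x_1 + \cdots + a_{d+1}x_{d+1}$ with $a_{d+1} > 0$ attains its minimum over the polytope, the face being the set of all minimizers. Then for every $1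 \le k \le d$ the number of lower faces of $\Pi_d(\lambda)$ of dimension $d-k$ is $$\sum_{r=k}^{d} (r-1)!\, S(d,r) \binom{r}{k} \binom{r+k}{k-1},$$ where $S(d,r)$ denotes a Stirling number of the second kind. -/

import Mathlib

open scoped Nat

/-- The `d`-box `B(λ)` of all points `x` of `ℝ^d` with `0 ≤ x_i ≤ λ_i` for all `i`. -/
def dBox {d : ℕ} (lam : Fin d → ℕ) : Set (Fin d → ℝ) :=
  {x | ∀ i, 0 ≤ x i ∧ x i ≤ (lam i : ℝ)}

/-- The vertex set of the pile of cubes: the integer points of the `d`-box. -/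
def pileVertices {d : ℕ} (lam : Fin d → ℕ) : Set (Fin d → ℝ) :=
  {x | x ∈ dBox lam ∧ ∀ i, ∃ m : ℤ, x i = (m : ℝ)}

/-- The lifted pile of cubes, the convex hull of the points `(x, x_1 ^ 2 + ⋯ + x_d ^ 2)` for the
vertices `x` of the pile of cubes. Here `ℝ^(d+1)` is written as `ℝ^d × ℝ`. -/
def liftedPile {d : ℕ} (lam : Fin d → ℕ) : Set ((Fin d → ℝ) × ℝ) :=
  convexHull ℝ ((fun x : Fin d → ℝ => (x, ∑ i, x i ^ 2)) '' pileVertices lam)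

/-- The sum of the first `d` coordinates of a point of `ℝ^(d+1)`. -/
def coordSum {d : ℕ} (p : (Fin d → ℝ) × ℝ) : ℝ := ∑ i, p.1 i

/-- `γ` is a section of the projection `π : P → π(P)`: it is continuous on `π(P)`, maps `π(P)` to
`P`, and `π ∘ γ` is the identity on `π(P)`. -/
def IsSectionOf {E : Type*} [TopologicalSpace E] (P : Set E) (π : E → ℝ) (γ : ℝ → E) : Prop :=
  ContinuousOn γ (π '' P) ∧ ∀ t ∈ π '' P, γ t ∈ P ∧ π (γ t) = t

/-- The monotone path polytope of a projection `π` of a polytope `P` onto a segment `Q = π(P)`: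
the set of the averages `(1 / vol Q) ∫_Q γ(t) dt` of all sections `γ` of `π`. -/
noncomputable def monotonePathPolytope {E : Type*} [NormedAddCommGroup E] [NormedSpace ℝ E]
    (P : Set E) (π : E → ℝ) : Set E :=
  {y | ∃ γ : ℝ → E, IsSectionOf P π γ ∧
    y = (MeasureTheory.volume (π '' P)).toReal⁻¹ • ∫ t in π '' P, γ t}

/-- The monotone path polytope `Π_d(λ)` of the lifted pile of cubes and the projection given by the
sum of the first `d` coordinates. -/
noncomputable def pilePathPolytope {d : ℕ} (lam : Fin d → ℕ) : Set ((Fin d → ℝ) × ℝ) :=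
  monotonePathPolytope (liftedPile lam) coordSum

/-- `F` is a lower face of the polytope `P` in `ℝ^d × ℝ`: a nonempty face which is the set of
minimizers on `P` of a linear functional whose coefficient at the last coordinate is positive. -/
def IsLowerFace {d : ℕ} (P F : Set ((Fin d → ℝ) × ℝ)) : Prop :=
  F.Nonempty ∧ ∃ c : ((Fin d → ℝ) × ℝ) →ₗ[ℝ] ℝ, 0 < c (0, 1) ∧
    F = {x | x ∈ P ∧ ∀ y ∈ P, c x ≤ c y}

/-- The dimension of a nonempty face, that is, of its affine hull. -/
noncomputable def faceDim {d : ℕ} (F : Set ((Fin d → ℝ) × ℝ)) : ℕ :=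
  Module.finrank ℝ (vectorSpan ℝ F)

/-! Scale a lower functional so that the height has coefficient 1; it becomes `pileCost a`. A
section has minimal average cost exactly when it is minimal in every fiber of the projection. The
lower boundary of the lifted pile is the graph of a separable function with slopes 1 and 3 in each
coordinate, so minimizing in a fiber is a fractional knapsack problem with `2d` unit boxes of prices
`a i + 1` and `a i + 3`, whose optima are the greedy fillings. Hence `pileFace a` depends only on
the strict order of these prices, and staircase paths, filling one box after the other, show that
different orders give different faces (`pileFace_eq_iff`). A vector `v` has constant scalar product
with the face exactly when moving `a` along `v` keeps all ties between prices; so the codimension of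
the face in `ℝ^d` is the dimension of the space of such `v`
(`faceDim_pileFace_add_finrank_tieSpace`).

It remains to count the order types of the values `a i` together with their shifts by 2. If `a`
takes the values `b 0 < ... < b (r-1)`, the assignment of coordinates to values is one of `r!
S(d,r)` surjections. For each `j`, record how many `b i + 2` are at most `b j`, and mark `j` if one
of them equals `b j`. These codes are lattice paths of Schröder type; each mark glues two values, so
`r - k` marks leave a tie space of dimension `k`. A recurrence with an explicit solution gives
`(1/r) binom(r,k) binom(r+k,k-1)` such codes (`encard_codeSet_self`), and the product with `r!
S(d,r)` is the summand. -/

/-! ### Greedy fillings and their optimality. -/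

/-- A filling `y` of boxes of unit capacity is greedy for the prices `s` if a box receives
something only after all strictly cheaper boxes are full. -/
def Greedy {ι : Type*} (s y : ι → ℝ) : Prop := ∀ α β, s α < s β → 0 < y β → y α = 1

/-- The threshold is the highest price of a box in use, or any lower bound of the prices if no box
is used. -/
theorem Greedy.exists_threshold {ι : Type*} [Finite ι] {s y : ι → ℝ} (h0 : ∀ α, 0 ≤ y α)
    (h : Greedy s y) : ∃ μ, (∀ α, s α < μ → y α = 1) ∧ ∀ α, μ < s α → y α = 0 := by
  by_cases hne : {α | 0 < y α}.Nonempty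
  · obtain ⟨β, hβ, hmax⟩ := Set.exists_max_image {α | 0 < y α} s (Set.toFinite _) hne
    refine ⟨s β, fun α hα => h α β hα hβ, fun α hα => ?_⟩
    by_contra hy
    exact absurd (hmax α (lt_of_le_of_ne (h0 α) (Ne.symm hy))) (not_le.2 hα)
  · obtain ⟨μ, hμ⟩ := (Set.finite_range s).bddBelow
    refine ⟨μ, fun α hα => absurd (hμ ⟨α, rfl⟩) (not_le.2 hα), fun α _ => ?_⟩
    by_contra hy
    exact hne ⟨α, lt_of_le_of_ne (h0 α) (Ne.symm hy)⟩

/-- With `μ` the threshold of `y`, every term `(s α - μ) * (g α - y α)` is nonnegative, and `μ`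
cancels because the totals agree. Equality of costs kills every term, so `g` can differ from `y`
only at price `μ`. -/
theorem Greedy.sum_le {ι : Type*} [Fintype ι] {s y g : ι → ℝ} (h : Greedy s y)
    (hy : ∀ α, 0 ≤ y α) (hg0 : ∀ α, 0 ≤ g α) (hg1 : ∀ α, g α ≤ 1)
    (hsum : ∑ α, y α = ∑ α, g α) :
    ∑ α, s α * y α ≤ ∑ α, s α * g α ∧
      (∑ α, s α * y α = ∑ α, s α * g α → Greedy s g) := by
  obtain ⟨μ, h1, h2⟩ := h.exists_threshold hy
  have hterm : ∀ α ∈ Finset.univ, 0 ≤ (s α - μ) * (g α - y α) := by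
    intro α _
    rcases lt_trichotomy (s α) μ with hα | hα | hα
    · rw [h1 α hα]; nlinarith [hg1 α]
    · simp [hα]
    · rw [h2 α hα]; nlinarith [hg0 α]
  have hdiff : ∑ α, (s α - μ) * (g α - y α) = ∑ α, s α * g α - ∑ α, s α * y α := by
    have : ∀ α, (s α - μ) * (g α - y α) = (s α * g α - s α * y α) - (μ * g α - μ * y α) :=
      fun α => by ring
    simp only [this, Finset.sum_sub_distrib, ← Finset.mul_sum, hsum]
    ring
  refine ⟨by linarith [Finset.sum_nonneg hterm], fun heq => ?_⟩
  rw [heq, sub_self] at hdiff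
  have hz := (Finset.sum_eq_zero_iff_of_nonneg hterm).1 hdiff
  intro α β hαβ hβ
  have hβμ : s β ≤ μ := by
    by_contra hlt
    push Not at hlt
    rcases mul_eq_zero.1 (hz β (Finset.mem_univ _)) with h' | h'
    · linarith
    · rw [h2 β hlt] at h'; linarith
  have hαμ : s α < μ := hαβ.trans_le hβμ
  rcases mul_eq_zero.1 (hz α (Finset.mem_univ _)) with h' | h'
  · linarith
  · rw [h1 α hαμ] at h'; linarith

/-! ### The lower boundary of the lifted pile. -/

/-- The convex piecewise linear interpolation of `u ^ 2` at `0, 1, 2`. -/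
noncomputable def sqInterp (u : ℝ) : ℝ := max u (3 * u - 2)

theorem sqInterp_eq (u : ℝ) : sqInterp u = min u 1 + 3 * max (u - 1) 0 := by
  unfold sqInterp
  rcases le_total u 1 with h | h
  · rw [max_eq_left (by linarith), min_eq_left h, max_eq_right (by linarith)]; ring
  · rw [max_eq_right (by linarith), min_eq_right h, max_eq_left (by linarith)]; ring

theorem sqInterp_convex {a b u v : ℝ} (ha : 0 ≤ a) (hb : 0 ≤ b) (hab : a + b = 1) :
    sqInterp (a * u + b * v) ≤ a * sqInterp u + b * sqInterp v := by
  unfold sqInterp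
  have h1 := mul_le_mul_of_nonneg_left (le_max_left u (3 * u - 2)) ha
  have h2 := mul_le_mul_of_nonneg_left (le_max_right u (3 * u - 2)) ha
  have h3 := mul_le_mul_of_nonneg_left (le_max_left v (3 * v - 2)) hb
  have h4 := mul_le_mul_of_nonneg_left (le_max_right v (3 * v - 2)) hb
  refine max_le (by linarith) ?_
  have : 3 * (a * u + b * v) - 2 = a * (3 * u - 2) + b * (3 * v - 2) := by linear_combination 2 * hab
  linarith

/-- The conclusion cuts out a convex set, which contains the generators because `sqInterp` agrees
with the square at 0, 1, 2. -/
theorem of_mem_liftedPile {d : ℕ} {p : (Fin d → ℝ) × ℝ}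
    (hp : p ∈ liftedPile (fun _ : Fin d => 2)) :
    (∀ i, 0 ≤ p.1 i ∧ p.1 i ≤ 2) ∧ ∑ i, sqInterp (p.1 i) ≤ p.2 := by
  have hconv : Convex ℝ {p : (Fin d → ℝ) × ℝ |
      (∀ i, 0 ≤ p.1 i ∧ p.1 i ≤ 2) ∧ ∑ i, sqInterp (p.1 i) ≤ p.2} := by
    rintro p ⟨hp1, hp2⟩ q ⟨hq1, hq2⟩ a b ha hb hab
    refine ⟨fun i => ?_, ?_⟩
    · simp only [Prod.fst_add, Prod.smul_fst, Pi.add_apply, Pi.smul_apply, smul_eq_mul]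
      have h1 := hp1 i
      have h2 := hq1 i
      constructor <;> nlinarith
    · simp only [Prod.fst_add, Prod.smul_fst, Pi.add_apply, Pi.smul_apply, smul_eq_mul,
        Prod.snd_add, Prod.smul_snd]
      calc ∑ i, sqInterp (a * p.1 i + b * q.1 i)
          ≤ ∑ i, (a * sqInterp (p.1 i) + b * sqInterp (q.1 i)) :=
            Finset.sum_le_sum fun i _ => sqInterp_convex ha hb hab
        _ = a * ∑ i, sqInterp (p.1 i) + b * ∑ i, sqInterp (q.1 i) := by
            rw [Finset.sum_add_distrib, Finset.mul_sum, Finset.mul_sum]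
        _ ≤ _ := by gcongr
  refine convexHull_min ?_ hconv hp
  rintro _ ⟨x, ⟨hx, hint⟩, rfl⟩
  refine ⟨fun i => by simpa using hx i, Finset.sum_le_sum fun i _ => ?_⟩
  obtain ⟨m, hm⟩ := hint i
  have h := hx i
  simp only [hm] at h ⊢
  have h0 : (0 : ℤ) ≤ m := by exact_mod_cast h.1
  have h2 : m ≤ (2 : ℤ) := by exact_mod_cast h.2
  unfold sqInterp
  interval_cases m <;> norm_num

/-- Convex hulls commute with products and linear images, so the claim reduces to the planar hull of
(0,0), (1,1), (2,4) in each coordinate. -/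
theorem mem_liftedPile {d : ℕ} {x : Fin d → ℝ} (hx : ∀ i, 0 ≤ x i ∧ x i ≤ 2) :
    (x, ∑ i, sqInterp (x i)) ∈ liftedPile (fun _ : Fin d => 2) := by
  let T : Set (ℝ × ℝ) := {(0, 0), (1, 1), (2, 4)}
  let A : (Fin d → ℝ × ℝ) →ₗ[ℝ] (Fin d → ℝ) × ℝ :=
    { toFun := fun w => (fun i => (w i).1, ∑ i, (w i).2)
      map_add' := fun v w => by
        ext <;> simp [Finset.sum_add_distrib]
      map_smul' := fun c w => by
        ext <;> simp [Finset.mul_sum] }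
  have hT : ∀ u : ℝ, 0 ≤ u → u ≤ 2 → (u, sqInterp u) ∈ convexHull ℝ T := by
    intro u h0 h2
    have m0 : ((0, 0) : ℝ × ℝ) ∈ convexHull ℝ T := subset_convexHull _ _ (by simp [T])
    have m1 : ((1, 1) : ℝ × ℝ) ∈ convexHull ℝ T := subset_convexHull _ _ (by simp [T])
    have m2 : ((2, 4) : ℝ × ℝ) ∈ convexHull ℝ T := subset_convexHull _ _ (by simp [T])
    unfold sqInterp
    rcases le_total u 1 with h | h
    · rw [max_eq_left (by linarith)]
      have := convex_convexHull ℝ T m0 m1 (sub_nonneg.2 h) h0 (by ring)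
      simpa using this
    · rw [max_eq_right (by linarith)]
      have := convex_convexHull ℝ T m1 m2 (sub_nonneg.2 h2) (sub_nonneg.2 h) (by ring)
      convert this using 1
      ext <;> simp <;> ring
  have hmem : (fun i => (x i, sqInterp (x i))) ∈
      convexHull ℝ (Set.univ.pi fun _ : Fin d => T) := by
    rw [convexHull_pi]
    exact fun i _ => hT _ (hx i).1 (hx i).2
  have himg : A (fun i => (x i, sqInterp (x i))) ∈
      convexHull ℝ (A '' Set.univ.pi fun _ : Fin d => T) := by
    rw [← A.image_convexHull]
    exact ⟨_, hmem, rfl⟩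
  refine convexHull_mono ?_ himg
  rintro _ ⟨w, hw, rfl⟩
  have hw' : ∀ i, w i = (0, 0) ∨ w i = (1, 1) ∨ w i = (2, 4) := fun i => hw i trivial
  refine ⟨fun i => (w i).1, ⟨fun i => ?_, fun i => ?_⟩, ?_⟩
  · rcases hw' i with h | h | h <;> simp [h]
  · rcases hw' i with h | h | h
    · exact ⟨0, by simp [h]⟩
    · exact ⟨1, by simp [h]⟩
    · exact ⟨2, by simp [h]⟩
  · change (_, _) = (_, _)
    congr 1
    refine Finset.sum_congr rfl fun i _ => ?_
    rcases hw' i with h | h | h <;> norm_num [h]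

/-! ### Minimal points of a fiber as greedy fillings. -/

/-- The slope of the cost of the first and of the second unit in a coordinate. -/
def pileSlope {d : ℕ} (a : Fin d → ℝ) (α : Fin d × Bool) : ℝ := a α.1 + cond α.2 3 1

/-- How much of the first and of the second unit in a coordinate is used. -/
noncomputable def pileFill {d : ℕ} (x : Fin d → ℝ) (α : Fin d × Bool) : ℝ :=
  cond α.2 (max (x α.1 - 1) 0) (min (x α.1) 1)

/-- The value of the functional with coefficients `a` and `1`. -/
def pileCost {d : ℕ} (a : Fin d → ℝ) (p : (Fin d → ℝ) × ℝ) : ℝ := ∑ i, a i * p.1 i + p.2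

/-- The points of the lifted pile that minimize `pileCost a` in their fiber. -/
def PileOptimal {d : ℕ} (a : Fin d → ℝ) (p : (Fin d → ℝ) × ℝ) : Prop :=
  p.2 = ∑ i, sqInterp (p.1 i) ∧ Greedy (pileSlope a) (pileFill p.1)

theorem sum_pileFill {d : ℕ} (x : Fin d → ℝ) : ∑ α, pileFill x α = ∑ i, x i := by
  rw [Fintype.sum_prod_type]
  refine Finset.sum_congr rfl fun i _ => ?_
  simp only [Fintype.sum_bool, pileFill, cond_true, cond_false]
  rcases le_total (x i) 1 with h | h
  · rw [max_eq_right (by linarith), min_eq_left h]; ring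
  · rw [max_eq_left (by linarith), min_eq_right h]; ring

theorem sum_pileSlope_mul_pileFill {d : ℕ} (a x : Fin d → ℝ) :
    ∑ α, pileSlope a α * pileFill x α = ∑ i, a i * x i + ∑ i, sqInterp (x i) := by
  rw [Fintype.sum_prod_type, ← Finset.sum_add_distrib]
  refine Finset.sum_congr rfl fun i _ => ?_
  simp only [Fintype.sum_bool, pileFill, pileSlope, cond_true, cond_false, sqInterp_eq]
  rcases le_total (x i) 1 with h | h
  · rw [max_eq_right (by linarith), min_eq_left h]; ring
  · rw [max_eq_left (by linarith), min_eq_right h]; ring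

theorem pileFill_nonneg {d : ℕ} {x : Fin d → ℝ} (hx : ∀ i, 0 ≤ x i ∧ x i ≤ 2)
    (α : Fin d × Bool) : 0 ≤ pileFill x α := by
  obtain ⟨i, _ | _⟩ := α <;> simp [pileFill, (hx i).1]

theorem pileFill_le_one {d : ℕ} {x : Fin d → ℝ} (hx : ∀ i, 0 ≤ x i ∧ x i ≤ 2)
    (α : Fin d × Bool) : pileFill x α ≤ 1 := by
  obtain ⟨i, _ | _⟩ := α <;> simp [pileFill]
  linarith [(hx i).2]

/-- The cost of `q` is the price of its filling plus its height above the lower boundary. Equality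
forces the height to vanish and the filling to be greedy. -/
theorem PileOptimal.cost_le {d : ℕ} {a : Fin d → ℝ} {p q : (Fin d → ℝ) × ℝ}
    (hopt : PileOptimal a p) (hp : p ∈ liftedPile (fun _ : Fin d => 2))
    (hq : q ∈ liftedPile (fun _ : Fin d => 2)) (hpq : coordSum p = coordSum q) :
    pileCost a p ≤ pileCost a q ∧ (pileCost a p = pileCost a q → PileOptimal a q) := by
  obtain ⟨hp1, -⟩ := of_mem_liftedPile hp
  obtain ⟨hq1, hq2⟩ := of_mem_liftedPile hq
  have key := hopt.2.sum_le (pileFill_nonneg hp1) (pileFill_nonneg hq1) (pileFill_le_one hq1)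
    (by simpa [sum_pileFill, coordSum] using hpq)
  simp only [sum_pileSlope_mul_pileFill] at key
  have hcp : pileCost a p = ∑ i, a i * p.1 i + ∑ i, sqInterp (p.1 i) := by
    rw [pileCost, hopt.1]
  rw [hcp, pileCost]
  refine ⟨by linarith [key.1], fun heq => ?_⟩
  have h2 : q.2 = ∑ i, sqInterp (q.1 i) := by linarith [key.1]
  exact ⟨h2, key.2 (by rw [heq, h2])⟩

/-! ### Staircase paths. -/

/-- The truncation of `u` to the unit interval. -/
noncomputable def ramp (u : ℝ) : ℝ := max 0 (min 1 u)

theorem ramp_nonneg (u : ℝ) : 0 ≤ ramp u := le_max_left _ _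

theorem ramp_le_one (u : ℝ) : ramp u ≤ 1 := max_le zero_le_one (min_le_left _ _)

theorem ramp_of_nonpos {u : ℝ} (h : u ≤ 0) : ramp u = 0 :=
  max_eq_left ((min_le_right _ _).trans h)

theorem ramp_of_one_le {u : ℝ} (h : 1 ≤ u) : ramp u = 1 := by
  rw [ramp, min_eq_left h, max_eq_right zero_le_one]

theorem ramp_mono {u v : ℝ} (h : u ≤ v) : ramp u ≤ ramp v := by
  unfold ramp; gcongr

theorem continuous_ramp : Continuous ramp := by
  unfold ramp; fun_prop

theorem sum_ramp (n : ℕ) {t : ℝ} (ht : 0 ≤ t) :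
    ∑ m ∈ Finset.range n, ramp (t - m) = min t n := by
  induction n with
  | zero => simp [ht]
  | succ n ih =>
    rw [Finset.sum_range_succ, ih]
    push_cast
    rcases le_total t n with h | h
    · rw [ramp_of_nonpos (by linarith), min_eq_left h, min_eq_left (by linarith), add_zero]
    · rw [min_eq_right h]
      rcases le_total t (n + 1) with h' | h'
      · rw [min_eq_left h', ramp, min_eq_right (by linarith), max_eq_right (by linarith)]
        ring
      · rw [min_eq_right h', ramp_of_one_le (by linarith)]

/-- The numbering `pos` lists the boxes by nondecreasing price. -/
def SortedBy {ι : Type*} {N : ℕ} (s : ι → ℝ) (pos : ι ≃ Fin N) : Prop :=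
  ∀ α β, pos α < pos β → s α ≤ s β

theorem exists_sortedBy {ι : Type*} [Fintype ι] {N : ℕ} (hN : Fintype.card ι = N) (s : ι → ℝ) :
    ∃ pos : ι ≃ Fin N, SortedBy s pos := by
  let e := Fintype.equivFinOfCardEq hN
  refine ⟨e.trans (Tuple.sort (s ∘ e.symm)).symm, fun α β h => ?_⟩
  have := Tuple.monotone_sort (s ∘ e.symm) h.le
  simpa using this

/-- Tied boxes may be listed in either order; comparing the two staircase paths is how a face
reveals its ties. -/
theorem SortedBy.swap {ι : Type*} [DecidableEq ι] {N : ℕ} {s : ι → ℝ} {pos : ι ≃ Fin N}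
    (h : SortedBy s pos) {α β : ι} (hαβ : s α = s β) :
    SortedBy s ((Equiv.swap α β).trans pos) := by
  have hs : ∀ γ, s (Equiv.swap α β γ) = s γ := by
    intro γ
    rcases eq_or_ne γ α with rfl | h1
    · rw [Equiv.swap_apply_left, hαβ]
    rcases eq_or_ne γ β with rfl | h2
    · rw [Equiv.swap_apply_right, hαβ]
    rw [Equiv.swap_apply_of_ne_of_ne h1 h2]
  intro γ δ hγδ
  simpa only [hs] using h _ _ hγδ

/-- The filling that fills the boxes one after the other in the order `pos`. -/
noncomputable def rampFill {ι : Type*} {N : ℕ} (pos : ι ≃ Fin N) (t : ℝ) (α : ι) : ℝ :=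
  ramp (t - (pos α : ℕ))

theorem sum_rampFill {ι : Type*} [Fintype ι] {N : ℕ} (pos : ι ≃ Fin N) {t : ℝ}
    (ht : t ∈ Set.Icc (0 : ℝ) N) : ∑ α, rampFill pos t α = t := by
  unfold rampFill
  rw [pos.sum_comp (fun m : Fin N => ramp (t - (m : ℕ))),
    Fin.sum_univ_eq_sum_range (fun m : ℕ => ramp (t - m)) N, sum_ramp N ht.1, min_eq_left ht.2]

theorem rampFill_eq_one {ι : Type*} {N : ℕ} {pos : ι ≃ Fin N} {t : ℝ} {α β : ι}
    (h : pos α < pos β) (hβ : 0 < rampFill pos t β) : rampFill pos t α = 1 := by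
  refine ramp_of_one_le ?_
  have h1 : ((pos α : ℕ) : ℝ) + 1 ≤ (pos β : ℕ) := by exact_mod_cast h
  by_contra h2
  rw [rampFill, ramp_of_nonpos (by linarith)] at hβ
  exact lt_irrefl _ hβ

theorem SortedBy.greedy {ι : Type*} {N : ℕ} {s : ι → ℝ} {pos : ι ≃ Fin N}
    (h : SortedBy s pos) (t : ℝ) : Greedy s (rampFill pos t) := by
  intro α β hαβ hβ
  refine rampFill_eq_one ?_ hβ
  by_contra hlt
  rcases (not_lt.1 hlt).lt_or_eq with h1 | h1
  · exact absurd (h _ _ h1) (not_le.2 hαβ)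
  · rw [pos.injective h1] at hαβ
    exact lt_irrefl _ hαβ

/-- The point of the staircase path of the pile given by the order `pos`, at time `t`. -/
noncomputable def stairPath {d : ℕ} (pos : Fin d × Bool ≃ Fin (d * 2)) (t : ℝ) :
    (Fin d → ℝ) × ℝ :=
  (fun i => rampFill pos t (i, false) + rampFill pos t (i, true),
    ∑ i, sqInterp (rampFill pos t (i, false) + rampFill pos t (i, true)))

section

variable {d : ℕ} {a : Fin d → ℝ} {pos : Fin d × Bool ≃ Fin (d * 2)}

theorem SortedBy.pos_lt (h : SortedBy (pileSlope a) pos) (i : Fin d) :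
    pos (i, false) < pos (i, true) := by
  by_contra hlt
  rcases (not_lt.1 hlt).lt_or_eq with h1 | h1
  · have := h _ _ h1
    simp only [pileSlope, cond_true, cond_false] at this
    linarith
  · simpa using pos.injective h1

/-- The second unit of a coordinate is always dearer than the first, so it starts only once the
first is full; thus the two fillings can be read off from their sum. -/
theorem SortedBy.pileFill_stairPath (h : SortedBy (pileSlope a) pos) (t : ℝ) :
    pileFill (stairPath pos t).1 = rampFill pos t := by
  ext ⟨i, j⟩
  have h1 : rampFill pos t (i, false) ≤ 1 := ramp_le_one _
  have h0 : 0 ≤ rampFill pos t (i, true) := ramp_nonneg _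
  rcases h0.eq_or_lt with h2 | h2
  · cases j
    · simp [pileFill, stairPath, ← h2, h1]
    · simp [pileFill, stairPath, ← h2, h1]
  · have h3 := rampFill_eq_one (h.pos_lt i) h2
    cases j
    · simp [pileFill, stairPath, h3, h0]
    · simp [pileFill, stairPath, h3, h0]

theorem SortedBy.optimal_stairPath (h : SortedBy (pileSlope a) pos) (t : ℝ) :
    PileOptimal a (stairPath pos t) :=
  ⟨rfl, by rw [h.pileFill_stairPath]; exact h.greedy t⟩

theorem stairPath_mem (t : ℝ) :
    stairPath pos t ∈ liftedPile (fun _ : Fin d => 2) := by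
  refine mem_liftedPile fun i => ⟨add_nonneg (ramp_nonneg _) (ramp_nonneg _), ?_⟩
  have h1 : rampFill pos t (i, false) ≤ 1 := ramp_le_one _
  have h2 : rampFill pos t (i, true) ≤ 1 := ramp_le_one _
  linarith

theorem coordSum_stairPath {t : ℝ} (ht : t ∈ Set.Icc (0 : ℝ) ((d * 2 : ℕ) : ℝ)) :
    coordSum (stairPath pos t) = t := by
  conv_rhs => rw [← sum_rampFill pos ht, Fintype.sum_prod_type]
  refine Finset.sum_congr rfl fun i _ => ?_
  rw [Fintype.sum_bool, add_comm]
  rfl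

theorem continuous_stairPath : Continuous (stairPath pos) := by
  unfold stairPath rampFill sqInterp
  have := continuous_ramp
  fun_prop

end

theorem exists_sortedBy_pileSlope {d : ℕ} (a : Fin d → ℝ) :
    ∃ pos : Fin d × Bool ≃ Fin (d * 2), SortedBy (pileSlope a) pos :=
  exists_sortedBy (by simp) _

theorem coordSum_image_liftedPile (d : ℕ) :
    coordSum '' liftedPile (fun _ : Fin d => 2) = Set.Icc (0 : ℝ) ((d * 2 : ℕ) : ℝ) := by
  ext t
  constructor
  · rintro ⟨p, hp, rfl⟩
    have h := (of_mem_liftedPile hp).1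
    refine ⟨Finset.sum_nonneg fun i _ => (h i).1, ?_⟩
    calc ∑ i, p.1 i ≤ ∑ _i : Fin d, (2 : ℝ) := Finset.sum_le_sum fun i _ => (h i).2
      _ = _ := by simp
  · intro ht
    obtain ⟨pos, -⟩ := exists_sortedBy_pileSlope (0 : Fin d → ℝ)
    exact ⟨_, stairPath_mem t, coordSum_stairPath (pos := pos) ht⟩

/-! ### Sections, their averages and the lower faces. -/

/-- A section of the projection of the lifted pile by the coordinate sum. -/
abbrev IsPileSection {d : ℕ} (γ : ℝ → (Fin d → ℝ) × ℝ) : Prop :=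
  IsSectionOf (liftedPile (fun _ : Fin d => 2)) coordSum γ

theorem isPileSection_iff {d : ℕ} {γ : ℝ → (Fin d → ℝ) × ℝ} :
    IsPileSection γ ↔ ContinuousOn γ (Set.Icc (0 : ℝ) ((d * 2 : ℕ) : ℝ)) ∧
      ∀ t ∈ Set.Icc (0 : ℝ) ((d * 2 : ℕ) : ℝ),
        γ t ∈ liftedPile (fun _ : Fin d => 2) ∧ coordSum (γ t) = t := by
  rw [IsPileSection, IsSectionOf, coordSum_image_liftedPile]

theorem isPileSection_stairPath {d : ℕ} (pos : Fin d × Bool ≃ Fin (d * 2)) :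
    IsPileSection (stairPath pos) :=
  isPileSection_iff.2 ⟨continuous_stairPath.continuousOn,
    fun t ht => ⟨stairPath_mem t, coordSum_stairPath ht⟩⟩

/-- The average of a path over `[0, 2d]`. -/
noncomputable def pileAverage {d : ℕ} (γ : ℝ → (Fin d → ℝ) × ℝ) : (Fin d → ℝ) × ℝ :=
  ((d * 2 : ℕ) : ℝ)⁻¹ • ∫ t in (0 : ℝ)..((d * 2 : ℕ) : ℝ), γ t

theorem mem_pilePathPolytope {d : ℕ} {y : (Fin d → ℝ) × ℝ} :
    y ∈ pilePathPolytope (fun _ : Fin d => 2) ↔ ∃ γ, IsPileSection γ ∧ y = pileAverage γ := by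
  have hvol : (MeasureTheory.volume (Set.Icc (0 : ℝ) ((d * 2 : ℕ) : ℝ))).toReal =
      ((d * 2 : ℕ) : ℝ) := by
    rw [Real.volume_Icc, sub_zero, ENNReal.toReal_ofReal (Nat.cast_nonneg _)]
  simp only [pilePathPolytope, monotonePathPolytope, coordSum_image_liftedPile, hvol,
    Set.mem_ofPred_eq, pileAverage, intervalIntegral.integral_of_le (Nat.cast_nonneg (d * 2)),
    MeasureTheory.integral_Icc_eq_integral_Ioc]

/-- `pileCost a` as a linear functional. -/
def pileCostLinear {d : ℕ} (a : Fin d → ℝ) : ((Fin d → ℝ) × ℝ) →ₗ[ℝ] ℝ where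
  toFun := pileCost a
  map_add' p q := by
    simp only [pileCost, Prod.fst_add, Pi.add_apply, mul_add, Finset.sum_add_distrib,
      Prod.snd_add]
    ring
  map_smul' c p := by
    simp only [pileCost, Prod.smul_fst, Pi.smul_apply, smul_eq_mul, Prod.smul_snd,
      RingHom.id_apply, mul_add, Finset.mul_sum]
    congr 1
    exact Finset.sum_congr rfl fun i _ => by ring

theorem continuous_pileCost {d : ℕ} (a : Fin d → ℝ) : Continuous (pileCost a) :=
  (pileCostLinear a).continuous_of_finiteDimensional

theorem pileCost_pileAverage {d : ℕ} (a : Fin d → ℝ) {γ : ℝ → (Fin d → ℝ) × ℝ}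
    (hγ : IsPileSection γ) :
    pileCost a (pileAverage γ) =
      ((d * 2 : ℕ) : ℝ)⁻¹ * ∫ t in (0 : ℝ)..((d * 2 : ℕ) : ℝ), pileCost a (γ t) := by
  have hint : IntervalIntegrable γ MeasureTheory.volume 0 ((d * 2 : ℕ) : ℝ) := by
    refine ContinuousOn.intervalIntegrable ?_
    rw [Set.uIcc_of_le (Nat.cast_nonneg _)]
    exact (isPileSection_iff.1 hγ).1
  have h := (LinearMap.toContinuousLinearMap (pileCostLinear a)).intervalIntegral_comp_comm hint
  change (∫ t in (0 : ℝ)..((d * 2 : ℕ) : ℝ), pileCost a (γ t)) = pileCostLinear a _ at h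
  change pileCostLinear a _ = _
  rw [h, pileAverage, map_smul, smul_eq_mul]

/-- The face of the path polytope on which `pileCost a` is minimal. -/
def pileFace {d : ℕ} (a : Fin d → ℝ) : Set ((Fin d → ℝ) × ℝ) :=
  {y | y ∈ pilePathPolytope (fun _ : Fin d => 2) ∧
    ∀ y' ∈ pilePathPolytope (fun _ : Fin d => 2), pileCost a y ≤ pileCost a y'}

theorem pileAverage_mem_pileFace {d : ℕ} {a : Fin d → ℝ} {γ : ℝ → (Fin d → ℝ) × ℝ}
    (hγ : IsPileSection γ)
    (hopt : ∀ t ∈ Set.Icc (0 : ℝ) ((d * 2 : ℕ) : ℝ), PileOptimal a (γ t)) :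
    pileAverage γ ∈ pileFace a := by
  refine ⟨mem_pilePathPolytope.2 ⟨γ, hγ, rfl⟩, fun y' hy' => ?_⟩
  obtain ⟨δ, hδ, rfl⟩ := mem_pilePathPolytope.1 hy'
  rw [pileCost_pileAverage a hγ, pileCost_pileAverage a hδ]
  obtain ⟨hγc, hγm⟩ := isPileSection_iff.1 hγ
  obtain ⟨hδc, hδm⟩ := isPileSection_iff.1 hδ
  have h0 : (0 : ℝ) ≤ ((d * 2 : ℕ) : ℝ) := Nat.cast_nonneg _
  refine mul_le_mul_of_nonneg_left ?_ (inv_nonneg.2 h0)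
  refine intervalIntegral.integral_mono_on h0 ?_ ?_ fun t ht =>
    ((hopt t ht).cost_le (hγm t ht).1 (hδm t ht).1
      ((hγm t ht).2.trans (hδm t ht).2.symm)).1
  · refine ContinuousOn.intervalIntegrable ?_
    rw [Set.uIcc_of_le h0]
    exact (continuous_pileCost a).comp_continuousOn hγc
  · refine ContinuousOn.intervalIntegrable ?_
    rw [Set.uIcc_of_le h0]
    exact (continuous_pileCost a).comp_continuousOn hδc

/-- A sorted staircase path is nowhere more expensive than `γ`, while its integral is at least as
large. By continuity the costs agree everywhere, and the equality case of `PileOptimal.cost_le`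
applies. -/
theorem pileOptimal_of_pileAverage_mem_pileFace {d : ℕ} (hd : 0 < d) {a : Fin d → ℝ}
    {γ : ℝ → (Fin d → ℝ) × ℝ} (hγ : IsPileSection γ) (hmem : pileAverage γ ∈ pileFace a)
    {t : ℝ} (ht : t ∈ Set.Icc (0 : ℝ) ((d * 2 : ℕ) : ℝ)) : PileOptimal a (γ t) := by
  obtain ⟨pos, hpos⟩ := exists_sortedBy_pileSlope a
  have hσ := isPileSection_stairPath pos
  have hle := hmem.2 _ (mem_pilePathPolytope.2 ⟨_, hσ, rfl⟩)
  rw [pileCost_pileAverage a hγ, pileCost_pileAverage a hσ] at hle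
  have h0 : (0 : ℝ) < ((d * 2 : ℕ) : ℝ) := by positivity
  have hle := le_of_mul_le_mul_left hle (inv_pos.2 h0)
  obtain ⟨hγc, hγm⟩ := isPileSection_iff.1 hγ
  obtain ⟨hσc, hσm⟩ := isPileSection_iff.1 hσ
  have key : ∀ t ∈ Set.Icc (0 : ℝ) ((d * 2 : ℕ) : ℝ), _ := fun t ht =>
    (hpos.optimal_stairPath t).cost_le (hσm t ht).1 (hγm t ht).1
      ((hσm t ht).2.trans (hγm t ht).2.symm)
  refine (key t ht).2 (le_antisymm (key t ht).1 ?_)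
  by_contra hlt
  refine absurd hle (not_le.2 ?_)
  exact intervalIntegral.integral_lt_integral_of_continuousOn_of_le_of_exists_lt h0
    ((continuous_pileCost a).comp_continuousOn hσc)
    ((continuous_pileCost a).comp_continuousOn hγc)
    (fun u hu => (key u (Set.Ioc_subset_Icc_self hu)).1) ⟨t, ht, not_le.1 hlt⟩

theorem SortedBy.pileAverage_stairPath_mem {d : ℕ} {a : Fin d → ℝ}
    {pos : Fin d × Bool ≃ Fin (d * 2)} (h : SortedBy (pileSlope a) pos) :
    pileAverage (stairPath pos) ∈ pileFace a :=
  pileAverage_mem_pileFace (isPileSection_stairPath pos) fun t _ => h.optimal_stairPath t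

theorem pileFace_nonempty {d : ℕ} (a : Fin d → ℝ) : (pileFace a).Nonempty :=
  let ⟨_, hpos⟩ := exists_sortedBy_pileSlope a
  ⟨_, hpos.pileAverage_stairPath_mem⟩

theorem isLowerFace_iff {d : ℕ} {F : Set ((Fin d → ℝ) × ℝ)} :
    IsLowerFace (pilePathPolytope (fun _ : Fin d => 2)) F ↔ ∃ a, F = pileFace a := by
  constructor
  · rintro ⟨-, c, hc, rfl⟩
    -- Dividing by the positive last coefficient does not change the minimizers.
    refine ⟨fun i => c (Pi.single i 1, 0) / c (0, 1), ?_⟩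
    have hcost : ∀ p, c p = c (0, 1) * pileCost (fun i => c (Pi.single i 1, 0) / c (0, 1)) p := by
      intro p
      have hp : p = ∑ i, p.1 i • ((Pi.single i 1, 0) : (Fin d → ℝ) × ℝ) + p.2 • (0, 1) := by
        refine Prod.ext ?_ ?_
        · ext j
          simp [Prod.fst_sum, Finset.sum_apply, Pi.single_apply]
        · simp [Prod.snd_sum]
      conv_lhs => rw [hp]
      rw [map_add, map_sum, pileCost, mul_add, Finset.mul_sum]
      simp only [map_smul, smul_eq_mul]
      congr 1
      · refine Finset.sum_congr rfl fun i _ => ?_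
        field_simp
      · ring
    ext x
    refine and_congr_right fun _ => forall₂_congr fun y _ => ?_
    rw [hcost x, hcost y]
    exact mul_le_mul_iff_right₀ hc
  · rintro ⟨a, rfl⟩
    refine ⟨pileFace_nonempty a, pileCostLinear a, ?_, rfl⟩
    change 0 < pileCost a (0, 1)
    simp [pileCost]

/-! ### Lower faces correspond to slope orders. -/

/-- Two vectors induce the same strict order on the slopes of the pile. -/
def SameSlopeOrder {d : ℕ} (a b : Fin d → ℝ) : Prop :=
  ∀ α β, pileSlope a α < pileSlope a β ↔ pileSlope b α < pileSlope b β

/-- Fewer strict inequalities between prices make greediness a weaker condition. -/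
theorem pileFace_subset {d : ℕ} (hd : 0 < d) {a b : Fin d → ℝ}
    (h : ∀ α β, pileSlope b α < pileSlope b β → pileSlope a α < pileSlope a β) :
    pileFace a ⊆ pileFace b := by
  intro y hy
  obtain ⟨γ, hγ, rfl⟩ := mem_pilePathPolytope.1 hy.1
  refine pileAverage_mem_pileFace hγ fun t ht => ?_
  have := pileOptimal_of_pileAverage_mem_pileFace hd hγ hy ht
  exact ⟨this.1, fun α β hαβ => this.2 α β (h α β hαβ)⟩

theorem slope_lt_of_pileFace_subset {d : ℕ} (hd : 0 < d) {a b : Fin d → ℝ}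
    (h : pileFace b ⊆ pileFace a) {α β : Fin d × Bool} (hαβ : pileSlope a α < pileSlope a β) :
    pileSlope b α < pileSlope b β := by
  by_contra hb
  have hne : α ≠ β := by rintro rfl; exact lt_irrefl _ hαβ
  obtain ⟨pos, hpos, hlt⟩ : ∃ pos : Fin d × Bool ≃ Fin (d * 2),
      SortedBy (pileSlope b) pos ∧ pos β < pos α := by
    obtain ⟨pos, hpos⟩ := exists_sortedBy_pileSlope b
    rcases lt_trichotomy (pos β) (pos α) with h1 | h1 | h1
    · exact ⟨pos, hpos, h1⟩
    · exact absurd (pos.injective h1).symm hne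
    · refine ⟨_, hpos.swap (le_antisymm (hpos _ _ h1) (not_lt.1 hb)), ?_⟩
      simpa using h1
  -- At this time box `β` has just become full while the later box `α` is still empty, which is not
  -- greedy for `a`.
  have ht : (((pos β : ℕ) : ℝ) + 1) ∈ Set.Icc (0 : ℝ) ((d * 2 : ℕ) : ℝ) := by
    refine ⟨by positivity, ?_⟩
    exact_mod_cast (pos β).2
  have hopt := pileOptimal_of_pileAverage_mem_pileFace hd (isPileSection_stairPath pos)
    (h hpos.pileAverage_stairPath_mem) ht
  have hG := hopt.2 α β hαβ
  rw [hpos.pileFill_stairPath] at hG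
  have h1 : rampFill pos (((pos β : ℕ) : ℝ) + 1) β = 1 := ramp_of_one_le (by linarith)
  have h2 : rampFill pos (((pos β : ℕ) : ℝ) + 1) α = 0 := by
    refine ramp_of_nonpos ?_
    have : ((pos β : ℕ) : ℝ) + 1 ≤ (pos α : ℕ) := by exact_mod_cast hlt
    linarith
  rw [h1, h2] at hG
  exact zero_ne_one (hG one_pos)

theorem pileFace_eq_iff {d : ℕ} (hd : 0 < d) {a b : Fin d → ℝ} :
    pileFace a = pileFace b ↔ SameSlopeOrder a b :=
  ⟨fun h _ _ => ⟨slope_lt_of_pileFace_subset hd h.ge, slope_lt_of_pileFace_subset hd h.le⟩,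
    fun h => (pileFace_subset hd fun α β => (h α β).2).antisymm
      (pileFace_subset hd fun α β => (h α β).1)⟩

/-! ### The dimension of a lower face. -/

theorem integral_ramp_lt {N p q : ℕ} (hpq : p < q) (hq : q < N) :
    ∫ t in (0 : ℝ)..N, ramp (t - q) < ∫ t in (0 : ℝ)..N, ramp (t - p) := by
  have hN : (0 : ℝ) < N := by exact_mod_cast (Nat.zero_le q).trans_lt hq
  have h1 : (p : ℝ) + 1 ≤ q := by exact_mod_cast hpq
  refine intervalIntegral.integral_lt_integral_of_continuousOn_of_le_of_exists_lt hN
    (continuous_ramp.comp (by fun_prop)).continuousOn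
    (continuous_ramp.comp (by fun_prop)).continuousOn
    (fun t _ => ramp_mono (by linarith))
    ⟨q, ⟨Nat.cast_nonneg q, by exact_mod_cast hq.le⟩, ?_⟩
  rw [sub_self, ramp_of_nonpos le_rfl, ramp_of_one_le (by linarith)]
  exact one_pos

theorem integral_ramp_ne {N p q : ℕ} (hpq : p ≠ q) (hp : p < N) (hq : q < N) :
    ∫ t in (0 : ℝ)..N, ramp (t - p) ≠ ∫ t in (0 : ℝ)..N, ramp (t - q) := by
  rcases hpq.lt_or_gt with h | h
  · exact (integral_ramp_lt h hq).ne'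
  · exact (integral_ramp_lt h hp).ne

/-- The directions in which the ties between the slopes of the pile are preserved. -/
def tieSpace {d : ℕ} (a : Fin d → ℝ) : Submodule ℝ (Fin d → ℝ) where
  carrier := {v | ∀ α β, pileSlope a α = pileSlope a β → v α.1 = v β.1}
  add_mem' hv hw α β h := by
    rw [Pi.add_apply, Pi.add_apply, hv α β h, hw α β h]
  zero_mem' _ _ _ := rfl
  smul_mem' c v hv α β h := by
    rw [Pi.smul_apply, Pi.smul_apply, hv α β h]

theorem pileSlope_add_smul {d : ℕ} (a v : Fin d → ℝ) (ε : ℝ) (α : Fin d × Bool) :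
    pileSlope (a + ε • v) α = pileSlope a α + ε * v α.1 := by
  simp only [pileSlope, Pi.add_apply, Pi.smul_apply, smul_eq_mul]; ring

theorem pileCost_add_smul {d : ℕ} (a v : Fin d → ℝ) (ε : ℝ) (p : (Fin d → ℝ) × ℝ) :
    pileCost (a + ε • v) p = pileCost a p + ε * (v ⬝ᵥ p.1) := by
  simp only [pileCost, Pi.add_apply, Pi.smul_apply, smul_eq_mul, dotProduct, add_mul,
    Finset.sum_add_distrib, Finset.mul_sum, mul_assoc]
  ring

/-- The finitely many strict inequalities survive a small perturbation, and `v` preserves the ties.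
-/
theorem exists_sameSlopeOrder_add_smul {d : ℕ} {a v : Fin d → ℝ} (hv : v ∈ tieSpace a) :
    ∃ ε : ℝ, 0 < ε ∧ SameSlopeOrder a (a + ε • v) := by
  have hev : ∀ᶠ ε in nhdsWithin (0 : ℝ) (Set.Ioi 0), ∀ α β, pileSlope a α < pileSlope a β →
      pileSlope (a + ε • v) α < pileSlope (a + ε • v) β := by
    refine Filter.Eventually.filter_mono nhdsWithin_le_nhds ?_
    rw [Filter.eventually_all]
    intro α
    rw [Filter.eventually_all]
    intro β
    by_cases h : pileSlope a α < pileSlope a β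
    · simp only [h, true_imp_iff, pileSlope_add_smul]
      refine ContinuousAt.eventually_lt (by fun_prop) (by fun_prop) ?_
      simpa using h
    · simp [h]
  obtain ⟨ε, hε, hpos⟩ := (hev.and self_mem_nhdsWithin).exists
  refine ⟨ε, hpos, fun α β => ⟨hε α β, fun h => ?_⟩⟩
  by_contra hle
  rcases (not_lt.1 hle).lt_or_eq with h1 | h1
  · exact absurd h (hε β α h1).not_gt
  · rw [pileSlope_add_smul, pileSlope_add_smul, h1, hv _ _ h1] at h
    exact lt_irrefl _ h

theorem pileCost_eq_of_mem_pileFace {d : ℕ} {a : Fin d → ℝ} {p q : (Fin d → ℝ) × ℝ}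
    (hp : p ∈ pileFace a) (hq : q ∈ pileFace a) : pileCost a p = pileCost a q :=
  (hp.2 q hq.1).antisymm (hq.2 p hp.1)

/-- The costs for `a` and for `a + ε • v` have the same minimizing face, so both are constant on it,
and hence so is their difference. -/
theorem dotProduct_eq_of_mem_pileFace {d : ℕ} (hd : 0 < d) {a v : Fin d → ℝ}
    (hv : v ∈ tieSpace a) {p q : (Fin d → ℝ) × ℝ} (hp : p ∈ pileFace a) (hq : q ∈ pileFace a) :
    v ⬝ᵥ p.1 = v ⬝ᵥ q.1 := by
  obtain ⟨ε, hε, hord⟩ := exists_sameSlopeOrder_add_smul hv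
  have h1 := pileCost_eq_of_mem_pileFace hp hq
  rw [(pileFace_eq_iff hd).2 hord] at hp hq
  have h2 := pileCost_eq_of_mem_pileFace hp hq
  rw [pileCost_add_smul, pileCost_add_smul, h1] at h2
  exact mul_left_cancel₀ hε.ne' (add_left_cancel h2)

theorem dotProduct_pileAverage {d : ℕ} (v : Fin d → ℝ) (pos : Fin d × Bool ≃ Fin (d * 2)) :
    v ⬝ᵥ (pileAverage (stairPath pos)).1 =
      ((d * 2 : ℕ) : ℝ)⁻¹ * ∑ α : Fin d × Bool, v α.1 *
        ∫ t in (0 : ℝ)..((d * 2 : ℕ) : ℝ), ramp (t - (pos α : ℕ)) := by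
  -- Writing the scalar product as a difference of costs makes `pileCost_pileAverage` applicable.
  have hdot : ∀ p : (Fin d → ℝ) × ℝ, v ⬝ᵥ p.1 = pileCost v p - pileCost 0 p := by
    intro p
    simp [pileCost, dotProduct]
  have hc : ∀ a : Fin d → ℝ, IntervalIntegrable (fun t => pileCost a (stairPath pos t))
      MeasureTheory.volume 0 ((d * 2 : ℕ) : ℝ) := fun a =>
    ((continuous_pileCost a).comp continuous_stairPath).intervalIntegrable _ _
  rw [hdot, pileCost_pileAverage _ (isPileSection_stairPath pos),
    pileCost_pileAverage _ (isPileSection_stairPath pos), ← mul_sub,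
    ← intervalIntegral.integral_sub (hc v) (hc 0)]
  congr 1
  simp only [← hdot, ← intervalIntegral.integral_const_mul]
  rw [← intervalIntegral.integral_finsetSum]
  · refine intervalIntegral.integral_congr fun t _ => ?_
    rw [Fintype.sum_prod_type]
    refine Finset.sum_congr rfl fun i _ => ?_
    simp only [Fintype.sum_bool, stairPath, rampFill]
    ring
  · intro α _
    exact (continuous_const.mul (continuous_ramp.comp (by fun_prop))).intervalIntegrable _ _

/-- Swapping two tied boxes changes the scalar product with the average by a nonzero multiple of `(v
α.1 - v β.1)` times the difference of two ramp integrals, and the latter is nonzero. -/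
theorem mem_tieSpace_of_dotProduct_eq {d : ℕ} (hd : 0 < d) {a v : Fin d → ℝ}
    (h : ∀ p ∈ pileFace a, ∀ q ∈ pileFace a, v ⬝ᵥ p.1 = v ⬝ᵥ q.1) : v ∈ tieSpace a := by
  intro α β hαβ
  by_contra hv
  have hne : α ≠ β := by rintro rfl; exact hv rfl
  obtain ⟨pos, hpos⟩ := exists_sortedBy_pileSlope a
  have heq := h _ hpos.pileAverage_stairPath_mem _ (hpos.swap hαβ).pileAverage_stairPath_mem
  rw [dotProduct_pileAverage, dotProduct_pileAverage] at heq
  have hN : ((d * 2 : ℕ) : ℝ)⁻¹ ≠ 0 := by positivity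
  have hsub := sub_eq_zero.2 (mul_left_cancel₀ hN heq)
  rw [← Finset.sum_sub_distrib, Fintype.sum_eq_add α β hne] at hsub
  · simp only [Equiv.trans_apply, Equiv.swap_apply_left, Equiv.swap_apply_right] at hsub
    have hI := integral_ramp_ne (N := d * 2) (p := pos α) (q := pos β)
      (fun h' => hne (pos.injective (Fin.ext h'))) (pos α).2 (pos β).2
    refine mul_ne_zero (sub_ne_zero.2 hv) (sub_ne_zero.2 hI) ?_
    linear_combination hsub
  · rintro γ ⟨h1, h2⟩
    rw [Equiv.trans_apply, Equiv.swap_apply_of_ne_of_ne h1 h2, sub_self]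

theorem faceDim_pileFace_add_finrank_tieSpace {d : ℕ} (hd : 0 < d) (a : Fin d → ℝ) :
    faceDim (pileFace a) + Module.finrank ℝ (tieSpace a) = d := by
  set W := vectorSpan ℝ (pileFace a) with hW
  have hWcost : ∀ w ∈ W, pileCost a w = 0 := by
    have : W ≤ LinearMap.ker (pileCostLinear a) := by
      rw [hW, vectorSpan_def, Submodule.span_le]
      rintro _ ⟨p, hp, q, hq, rfl⟩
      change pileCostLinear a (p - q) = 0
      rw [map_sub, sub_eq_zero]
      exact pileCost_eq_of_mem_pileFace hp hq
    exact this
  let W' := W.map (LinearMap.fst ℝ (Fin d → ℝ) ℝ)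
  -- The cost vanishes on `W`, so the first `d` coordinates determine the height and the projection
  -- loses no dimension.
  have hfin : Module.finrank ℝ W' = Module.finrank ℝ W := by
    have hinj : Function.Injective ((LinearMap.fst ℝ (Fin d → ℝ) ℝ).domRestrict W) := by
      rw [injective_iff_map_eq_zero]
      rintro ⟨w, hw⟩ h0
      have h1 : w.1 = 0 := h0
      have h2 := hWcost w hw
      rw [pileCost, h1] at h2
      exact Subtype.ext (Prod.ext h1 (by simpa using h2))
    rw [← LinearMap.finrank_range_of_inj hinj, LinearMap.range_domRestrict]
  let B : LinearMap.BilinForm ℝ (Fin d → ℝ) := dotProductBilin ℝ ℝ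
  have hB : B.Nondegenerate :=
    ⟨fun v hv => dotProduct_self_eq_zero.1 (hv v), fun v hv => dotProduct_self_eq_zero.1 (hv v)⟩
  have horth : B.orthogonal W' = tieSpace a := by
    ext v
    have h1 : v ∈ B.orthogonal W' ↔ ∀ w ∈ W, v ⬝ᵥ w.1 = 0 := by
      rw [LinearMap.BilinForm.mem_orthogonal_iff]
      constructor
      · intro h w hw
        rw [dotProduct_comm]
        exact h w.1 ⟨w, hw, rfl⟩
      · rintro h _ ⟨w, hw, rfl⟩
        change w.1 ⬝ᵥ v = 0
        rw [dotProduct_comm]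
        exact h w hw
    rw [h1]
    constructor
    · intro h
      refine mem_tieSpace_of_dotProduct_eq hd fun p hp q hq => ?_
      have := h _ (vsub_mem_vectorSpan ℝ hp hq)
      rwa [vsub_eq_sub, Prod.fst_sub, dotProduct_sub, sub_eq_zero] at this
    · intro hv
      have : W ≤ LinearMap.ker ((dotProductBilin ℝ ℝ v).comp
          (LinearMap.fst ℝ (Fin d → ℝ) ℝ)) := by
        rw [hW, vectorSpan_def, Submodule.span_le]
        rintro _ ⟨p, hp, q, hq, rfl⟩
        change v ⬝ᵥ (p.1 - q.1) = 0
        rw [dotProduct_sub, sub_eq_zero]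
        exact dotProduct_eq_of_mem_pileFace hd hv hp hq
      exact this
  have h2 := LinearMap.BilinForm.finrank_orthogonal hB W'
  have h3 := Submodule.finrank_le W'
  rw [horth, hfin] at h2
  rw [hfin] at h3
  rw [Module.finrank_fin_fun] at h2 h3
  change Module.finrank ℝ W + _ = d
  omega

/-! ### Counting surjections. -/

/-- The maps from `Fin d` with image `T`. -/
def mapsOnto {α : Type*} [DecidableEq α] (d : ℕ) (T : Finset α) : Finset (Fin d → α) :=
  (Fintype.piFinset fun _ : Fin d => T).filter fun f => Finset.univ.image f = T

theorem mem_mapsOnto {α : Type*} [DecidableEq α] {d : ℕ} {T : Finset α} {f : Fin d → α} :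
    f ∈ mapsOnto d T ↔ Finset.univ.image f = T := by
  rw [mapsOnto, Finset.mem_filter, Fintype.mem_piFinset, and_iff_right_iff_imp]
  rintro rfl i
  exact Finset.mem_image_of_mem _ (Finset.mem_univ i)

theorem image_cons_univ {α : Type*} [DecidableEq α] {d : ℕ} (x : α) (g : Fin d → α) :
    Finset.univ.image (Fin.cons x g : Fin (d + 1) → α) = insert x (Finset.univ.image g) := by
  ext y
  simp [Fin.exists_fin_succ, eq_comm]

/-- Once `f 0 = x` is fixed, the rest of `f` has image `T` or `T.erase x`; this is the Stirling
recurrence multiplied by a factorial. -/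
theorem card_mapsOnto {α : Type*} [DecidableEq α] (d : ℕ) (T : Finset α) :
    (mapsOnto d T).card = T.card ! * Nat.stirlingSecond d T.card := by
  induction d generalizing T with
  | zero =>
    rcases T.eq_empty_or_nonempty with rfl | hT
    · simp [mapsOnto]
    · obtain ⟨t, ht⟩ := Nat.exists_eq_succ_of_ne_zero hT.card_pos.ne'
      rw [ht, Nat.stirlingSecond_zero_succ, mul_zero, Finset.card_eq_zero,
        Finset.eq_empty_iff_forall_notMem]
      intro f hf
      rw [mem_mapsOnto] at hf
      simp [← hf] at hT
  | succ d ih =>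
    have hmaps : Set.MapsTo (fun f : Fin (d + 1) → α => f 0) (mapsOnto (d + 1) T) T := by
      intro f hf
      rw [Finset.mem_coe, mem_mapsOnto] at hf
      subst hf
      exact Finset.mem_coe.2 (Finset.mem_image_of_mem _ (Finset.mem_univ 0))
    have hfib : ∀ x ∈ T, ((mapsOnto (d + 1) T).filter fun f => f 0 = x).card =
        (mapsOnto d T).card + (mapsOnto d (T.erase x)).card := by
      intro x hx
      have hdisj : Disjoint (mapsOnto d T) (mapsOnto d (T.erase x)) := by
        rw [Finset.disjoint_left]
        intro f h1 h2
        rw [mem_mapsOnto] at h1 h2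
        exact Finset.notMem_erase x T (by rwa [← h2, h1])
      have hinj : Function.Injective fun g : Fin d → α => (Fin.cons x g : Fin (d + 1) → α) :=
        fun g g' h => by simpa using congrArg Fin.tail h
      rw [← Finset.card_union_of_disjoint hdisj, ← Finset.card_image_of_injective _ hinj]
      congr 1
      ext f
      rw [Finset.mem_filter, Finset.mem_image, mem_mapsOnto]
      constructor
      · rintro ⟨hf, rfl⟩
        refine ⟨Fin.tail f, ?_, Fin.cons_self_tail f⟩
        rw [← Fin.cons_self_tail f, image_cons_univ] at hf
        rw [Finset.mem_union, mem_mapsOnto, mem_mapsOnto]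
        by_cases h0 : f 0 ∈ Finset.univ.image (Fin.tail f)
        · left; rwa [Finset.insert_eq_self.2 h0] at hf
        · right
          rw [← hf, Finset.erase_insert h0]
      · rintro ⟨g, hg, rfl⟩
        refine ⟨?_, Fin.cons_zero _ _⟩
        rw [image_cons_univ]
        rw [Finset.mem_union, mem_mapsOnto, mem_mapsOnto] at hg
        rcases hg with hg | hg
        · rw [hg, Finset.insert_eq_self.2 hx]
        · rw [hg, Finset.insert_erase hx]
    rw [Finset.card_eq_sum_card_fiberwise hmaps, Finset.sum_congr rfl hfib]
    have hconst : ∀ x ∈ T, (mapsOnto d T).card + (mapsOnto d (T.erase x)).card =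
        T.card ! * Nat.stirlingSecond d T.card +
          (T.card - 1)! * Nat.stirlingSecond d (T.card - 1) := by
      intro x hx
      rw [ih, ih, Finset.card_erase_of_mem hx]
    rw [Finset.sum_congr rfl hconst, Finset.sum_const, smul_eq_mul]
    rcases T.card with _ | t
    · simp
    · rw [Nat.add_sub_cancel, Nat.stirlingSecond_succ_succ, Nat.factorial_succ]
      ring

/-! ### Codes and the recurrence for their number. -/

/-- The first component of the head of a list, or `0`. -/
def codeTop : List (ℕ × Bool) → ℕ
  | [] => 0
  | c :: _ => c.1

/-- The number of marked entries of a list. -/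
def tieCount : List (ℕ × Bool) → ℕ
  | [] => 0
  | c :: l => tieCount l + cond c.2 1 0

theorem codeTop_cons (c : ℕ × Bool) (l : List (ℕ × Bool)) : codeTop (c :: l) = c.1 := rfl

theorem tieCount_cons (c : ℕ × Bool) (l : List (ℕ × Bool)) :
    tieCount (c :: l) = tieCount l + cond c.2 1 0 := rfl

/-- A list, read from its end, is a valid code if its first components form a nondecreasing
sequence whose `j`-th term is at most `j` (counting from `0`), and marks occur only at strict
ascents. -/
def ValidCode : List (ℕ × Bool) → Prop
  | [] => True
  | c :: l => ValidCode l ∧ c.1 ≤ l.length ∧ codeTop l ≤ c.1 ∧ (c.2 = true → codeTop l < c.1)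

/-- The valid codes of length `n` with top at most `ℓ` and with `τ` marks. -/
def codeSet (n ℓ τ : ℕ) : Set (List (ℕ × Bool)) :=
  {l | ValidCode l ∧ l.length = n ∧ codeTop l ≤ ℓ ∧ tieCount l = τ}

theorem ValidCode.tieCount_le {l : List (ℕ × Bool)} (h : ValidCode l) :
    tieCount l ≤ codeTop l := by
  induction l with
  | nil => exact le_rfl
  | cons c l ih =>
    obtain ⟨h1, -, h3, h4⟩ := h
    have := ih h1
    obtain ⟨x, _ | _⟩ := c
    · simp only [tieCount_cons, codeTop_cons, cond_false] at *; omega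
    · simp only [tieCount_cons, codeTop_cons, cond_true] at *; have := h4 trivial; omega

theorem codeSet_eq_empty {n ℓ τ : ℕ} (h : ℓ < τ) : codeSet n ℓ τ = ∅ := by
  rw [Set.eq_empty_iff_forall_notMem]
  rintro l ⟨h1, -, h3, h4⟩
  have := h1.tieCount_le
  omega

theorem codeSet_succ_self (n τ : ℕ) : codeSet (n + 1) (n + 1) τ = codeSet (n + 1) n τ := by
  ext l
  refine ⟨fun ⟨h1, h2, h3, h4⟩ => ⟨h1, h2, ?_, h4⟩, fun ⟨h1, h2, h3, h4⟩ => ⟨h1, h2, by omega, h4⟩⟩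
  rcases l with _ | ⟨c, l⟩
  · exact Nat.zero_le _
  · have := h1.2.1
    simp only [List.length_cons] at h2
    change c.1 ≤ n
    omega

theorem codeSet_succ_zero (n : ℕ) :
    codeSet (n + 1) 0 0 = List.cons (0, false) '' codeSet n 0 0 := by
  ext l
  constructor
  · rintro ⟨h1, h2, h3, h4⟩
    rcases l with _ | ⟨⟨x, t⟩, l⟩
    · simp at h2
    · obtain ⟨g1, g2, g3, g4⟩ := h1
      simp only [codeTop_cons, List.length_cons, tieCount_cons] at *
      obtain rfl : x = 0 := by omega
      rcases t
      · exact ⟨l, ⟨g1, by omega, by omega, by simpa using h4⟩, rfl⟩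
      · have := g4 rfl; omega
  · rintro ⟨l, ⟨h1, h2, h3, h4⟩, rfl⟩
    exact ⟨⟨h1, by simp, h3, by simp⟩, by simp [h2], le_rfl, by simp [tieCount_cons, h4]⟩

theorem encard_codeSet_zero (n : ℕ) : (codeSet n 0 0).encard = 1 := by
  induction n with
  | zero =>
    rw [Set.encard_eq_one]
    refine ⟨[], Set.ext fun l => ?_⟩
    constructor
    · rintro ⟨-, h, -⟩
      exact List.length_eq_zero_iff.1 h
    · rintro rfl
      exact ⟨trivial, rfl, le_rfl, rfl⟩
  | succ n ih =>
    rw [codeSet_succ_zero, (List.cons_injective).encard_image, ih]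

/-- The head is below `ℓ + 1`, or equal to it without a mark, or equal to it with a mark; a mark
forces the remaining top down to `ℓ`. The condition `0 < τ` guards the truncated subtraction. -/
theorem codeSet_succ_succ {n ℓ : ℕ} (h : ℓ + 1 ≤ n) (τ : ℕ) :
    codeSet (n + 1) (ℓ + 1) τ = codeSet (n + 1) ℓ τ ∪
      List.cons (ℓ + 1, false) '' codeSet n (ℓ + 1) τ ∪
      List.cons (ℓ + 1, true) '' {l | l ∈ codeSet n ℓ (τ - 1) ∧ 0 < τ} := by
  ext l
  constructor
  · rintro ⟨h1, h2, h3, h4⟩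
    rcases l with _ | ⟨⟨x, t⟩, l⟩
    · simp at h2
    obtain ⟨g1, g2, g3, g4⟩ := id h1
    simp only [codeTop_cons, List.length_cons, tieCount_cons] at h2 h3 h4 g3 g4
    rcases h3.lt_or_eq with h5 | rfl
    · exact Or.inl (Or.inl ⟨h1, by simpa using h2, Nat.lt_succ_iff.1 h5, h4⟩)
    · rcases t
      · exact Or.inl (Or.inr ⟨l, ⟨g1, by omega, g3, by simpa using h4⟩, rfl⟩)
      · have := g4 rfl
        simp only [cond_true] at h4
        exact Or.inr ⟨l, ⟨⟨g1, by omega, by omega, by omega⟩, by omega⟩, rfl⟩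
  · rintro ((⟨h1, h2, h3, h4⟩ | ⟨l, ⟨h1, h2, h3, h4⟩, rfl⟩) | ⟨l, ⟨⟨h1, h2, h3, h4⟩, h5⟩, rfl⟩)
    · exact ⟨h1, h2, by omega, h4⟩
    · exact ⟨⟨h1, by simp; omega, h3, by simp⟩, by simp [h2], le_rfl, by simp [tieCount_cons, h4]⟩
    · refine ⟨⟨h1, by simp; omega, h3.trans (Nat.le_succ _), fun _ => Nat.lt_succ_of_le h3⟩,
        by simp [h2], le_rfl, ?_⟩
      simp only [tieCount_cons, cond_true, h4]
      omega

theorem encard_codeSet_succ_succ {n ℓ : ℕ} (h : ℓ + 1 ≤ n) (τ : ℕ) :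
    (codeSet (n + 1) (ℓ + 1) τ).encard = (codeSet (n + 1) ℓ τ).encard +
      (codeSet n (ℓ + 1) τ).encard + {l | l ∈ codeSet n ℓ (τ - 1) ∧ 0 < τ}.encard := by
  rw [codeSet_succ_succ h, Set.encard_union_eq, Set.encard_union_eq,
    (List.cons_injective).encard_image, (List.cons_injective).encard_image]
  · rw [Set.disjoint_left]
    rintro _ ⟨-, -, h3, -⟩ ⟨l, -, rfl⟩
    simp only [codeTop_cons] at h3
    omega
  · rw [Set.disjoint_left]
    rintro _ (⟨-, -, h3, -⟩ | ⟨l, -, rfl⟩) ⟨l', -, h'⟩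
    · rw [← h'] at h3
      simp only [codeTop_cons] at h3
      omega
    · simp at h'

/-! ### The closed formula for the number of codes. -/

/-- The number of valid codes of length `v + m + h` with top at most `v + m` and `m` marks. -/
noncomputable def codeFormula (v m h : ℕ) : ℚ :=
  ((v + m + h + v)! : ℚ) * ((h + 1) * (v + m + h) - m) /
    ((v + m + h) * (v + m + h + 1) * (v + h)! * v ! * m !)

/-- The boundary condition matching `codeSet_succ_self`. -/
theorem codeFormula_zero_right_succ (v m : ℕ) :
    codeFormula (v + 1) m 0 = codeFormula v m 1 := by
  have e1 : v + 1 + m + 0 + (v + 1) = (v + m + 1 + v) + 1 := by ring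
  have hf : ∀ n : ℕ, ((n ! : ℕ) : ℚ) ≠ 0 := fun n => by exact_mod_cast n.factorial_ne_zero
  have p1 : (v : ℚ) + m + 1 ≠ 0 := by positivity
  have p2 : (v : ℚ) + m + 2 ≠ 0 := by positivity
  have p3 : (v : ℚ) + 1 ≠ 0 := by positivity
  have q1 : (v : ℚ) + 1 + m + 0 = v + m + 1 := by ring
  have q2 : (v : ℚ) + m + 1 + 1 = v + m + 2 := by ring
  unfold codeFormula
  rw [e1, Nat.factorial_succ (v + m + 1 + v), add_zero (v + 1), Nat.factorial_succ v]
  push_cast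
  rw [q1, q2]
  have := hf (v + m + 1 + v)
  have := hf v
  have := hf m
  field_simp
  ring

theorem codeFormula_recurrence {v m h : ℕ} (hvm : 0 < v + m) {c₁ c₃ : ℚ}
    (h1 : (v = 0 ∧ c₁ = 0) ∨ ∃ v', v = v' + 1 ∧ c₁ = codeFormula v' m (h + 2))
    (h3 : (m = 0 ∧ c₃ = 0) ∨ ∃ m', m = m' + 1 ∧ c₃ = codeFormula v m' (h + 1)) :
    codeFormula v m (h + 1) = c₁ + codeFormula v m h + c₃ := by
  have hf : ∀ n : ℕ, ((n ! : ℕ) : ℚ) ≠ 0 := fun n => by exact_mod_cast n.factorial_ne_zero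
  have f1 := hf (v + m + h + v)
  have f2 := hf (v + h)
  have f3 := hf v
  have f4 := hf m
  have p0 : (v : ℚ) + m + h ≠ 0 := by
    have : (0 : ℚ) < v + m := by exact_mod_cast hvm
    positivity
  have p1 : (v : ℚ) + m + h + 1 ≠ 0 := by positivity
  have p2 : (v : ℚ) + m + h + 2 ≠ 0 := by positivity
  have p3 : (v : ℚ) + h + 1 ≠ 0 := by positivity
  -- The factor `v`, from `1 / (v - 1)! = v / v !`, vanishes at `v = 0`, so one expression covers
  -- both cases; `m` plays the same role in `hc3`.
  have hc1 : c₁ = ((v + m + h + v)! : ℚ) * v * ((h + 3) * (v + m + h + 1) - m) /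
      ((v + m + h + 1) * (v + m + h + 2) * ((v + h + 1) * (v + h)!) * v ! * m !) := by
    rcases h1 with ⟨rfl, rfl⟩ | ⟨v, rfl, rfl⟩
    · simp
    · have p4 : (v : ℚ) + 1 ≠ 0 := by positivity
      have g := hf v
      have e1 : v + m + (h + 2) + v = v + 1 + m + h + (v + 1) := by ring
      have e2 : v + (h + 2) = v + 1 + h + 1 := by ring
      have q1 : (v : ℚ) + m + (h + 2) = v + 1 + m + h + 1 := by ring
      have q2 : (v : ℚ) + 1 + m + h + 1 + 1 = v + 1 + m + h + 2 := by ring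
      unfold codeFormula
      rw [e1, e2, Nat.factorial_succ (v + 1 + h), Nat.factorial_succ v]
      push_cast at *
      rw [q1, q2]
      field_simp
      ring
  have hc3 : c₃ = ((v + m + h + v)! : ℚ) * m * ((h + 2) * (v + m + h) - m + 1) /
      ((v + m + h) * (v + m + h + 1) * ((v + h + 1) * (v + h)!) * v ! * m !) := by
    rcases h3 with ⟨rfl, rfl⟩ | ⟨m, rfl, rfl⟩
    · simp
    · have p4 : (m : ℚ) + 1 ≠ 0 := by positivity
      have g := hf m
      have e1 : v + m + (h + 1) + v = v + (m + 1) + h + v := by ring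
      have e2 : v + (h + 1) = v + h + 1 := by ring
      have q1 : (v : ℚ) + m + (h + 1) = v + (m + 1) + h := by ring
      unfold codeFormula
      rw [e1, e2, Nat.factorial_succ (v + h), Nat.factorial_succ m]
      push_cast at *
      rw [q1]
      field_simp
      ring
  rw [hc1, hc3]
  have e1 : v + m + (h + 1) + v = v + m + h + v + 1 := by ring
  have e2 : v + (h + 1) = v + h + 1 := by ring
  have q1 : (v : ℚ) + m + (h + 1) = v + m + h + 1 := by ring
  have q2 : (v : ℚ) + m + h + 1 + 1 = v + m + h + 2 := by ring
  unfold codeFormula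
  rw [e1, e2, Nat.factorial_succ (v + m + h + v), Nat.factorial_succ (v + h)]
  push_cast
  rw [q1, q2]
  field_simp
  ring

/-- Length 0 is excluded because the formula then reads `0 / 0 = 0`, although the empty code counts
once. -/
theorem encard_codeSet (n ℓ : ℕ) : ∀ v m h : ℕ, v + m + h = n → v + m = ℓ → 0 < n →
    ∃ c : ℕ, (codeSet n ℓ m).encard = c ∧ (c : ℚ) = codeFormula v m h := by
  induction n generalizing ℓ with
  | zero => intro v m h _ _ h0; exact absurd h0 (lt_irrefl _)
  | succ n ihn =>
    induction ℓ with
    | zero =>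
      intro v m h hn hl _
      obtain ⟨rfl, rfl⟩ : v = 0 ∧ m = 0 := by omega
      refine ⟨1, encard_codeSet_zero _, ?_⟩
      obtain rfl : h = n + 1 := by omega
      have p1 : (n : ℚ) + 1 ≠ 0 := by positivity
      have p2 : (n : ℚ) + 1 + 1 ≠ 0 := by positivity
      have hf : (((n + 1)! : ℕ) : ℚ) ≠ 0 := by exact_mod_cast (n + 1).factorial_ne_zero
      unfold codeFormula
      simp only [zero_add, add_zero, Nat.factorial_zero]
      push_cast
      simp only [zero_add, mul_one, sub_zero]
      field_simp
    | succ ℓ ihl =>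
      intro v m h hn hl _
      rcases h with _ | h
      · obtain rfl : ℓ = n := by omega
        rw [codeSet_succ_self]
        -- For `v = h = 0` there would be more marks than the top allows, and the numerator of the
        -- formula vanishes.
        rcases v with _ | v
        · refine ⟨0, ?_, ?_⟩
          · rw [codeSet_eq_empty (by omega)]; simp
          · unfold codeFormula
            simp
        · rw [codeFormula_zero_right_succ]
          exact ihl v m 1 (by omega) (by omega) (by omega)
      · rw [encard_codeSet_succ_succ (by omega)]
        obtain ⟨c₁, hc₁, hf₁⟩ : ∃ c : ℕ, (codeSet (n + 1) ℓ m).encard = c ∧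
            ((v = 0 ∧ (c : ℚ) = 0) ∨ ∃ v', v = v' + 1 ∧ (c : ℚ) = codeFormula v' m (h + 2)) := by
          rcases v with _ | v
          · refine ⟨0, ?_, Or.inl ⟨rfl, Nat.cast_zero⟩⟩
            rw [codeSet_eq_empty (by omega)]; simp
          · obtain ⟨c, hc, hf⟩ := ihl v m (h + 2) (by omega) (by omega) (by omega)
            exact ⟨c, hc, Or.inr ⟨v, rfl, hf⟩⟩
        obtain ⟨c₂, hc₂, hf₂⟩ := ihn (ℓ + 1) v m h (by omega) (by omega) (by omega)
        obtain ⟨c₃, hc₃, hf₃⟩ : ∃ c : ℕ, {l | l ∈ codeSet n ℓ (m - 1) ∧ 0 < m}.encard = c ∧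
            ((m = 0 ∧ (c : ℚ) = 0) ∨ ∃ m', m = m' + 1 ∧ (c : ℚ) = codeFormula v m' (h + 1)) := by
          rcases m with _ | m
          · exact ⟨0, by simp, Or.inl ⟨rfl, Nat.cast_zero⟩⟩
          · obtain ⟨c, hc, hf⟩ := ihn ℓ v m (h + 1) (by omega) (by omega) (by omega)
            exact ⟨c, by simpa using hc, Or.inr ⟨m, rfl, hf⟩⟩
        refine ⟨c₁ + c₂ + c₃, ?_, ?_⟩
        · rw [hc₁, hc₂, hc₃]; push_cast; rfl
        · rw [codeFormula_recurrence (by omega) hf₁ hf₃, ← hf₂]; push_cast; rfl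

theorem encard_codeSet_self {r k : ℕ} (hk : 1 ≤ k) (hkr : k ≤ r) :
    ∃ c : ℕ, (codeSet r r (r - k)).encard = c ∧
      r ! * c = (r - 1)! * r.choose k * (r + k).choose (k - 1) := by
  obtain ⟨j, rfl⟩ := Nat.exists_eq_add_of_le' hk
  obtain ⟨m, rfl⟩ := Nat.exists_eq_add_of_le hkr
  obtain ⟨c, hc, hf⟩ := encard_codeSet (j + 1 + m) (j + 1 + m) (j + 1) m 0 rfl rfl (by omega)
  refine ⟨c, by rw [Nat.add_sub_cancel_left]; exact hc, ?_⟩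
  have hfac : ∀ n : ℕ, ((n ! : ℕ) : ℚ) ≠ 0 := fun n => by exact_mod_cast n.factorial_ne_zero
  have e1 : j + 1 + m - 1 = j + m := by omega
  have e2 : j + 1 + m = j + m + 1 := by omega
  rw [e1, Nat.add_sub_cancel]
  have h1 : (((j + 1 + m).choose (j + 1) : ℕ) : ℚ) = (j + m + 1)! / ((j + 1)! * m !) := by
    rw [Nat.cast_choose ℚ (by omega), Nat.add_sub_cancel_left, e2]
  have h2 : (((j + 1 + m + (j + 1)).choose j : ℕ) : ℚ) =
      (j + 1 + m + (j + 1))! / (j ! * (j + m + 2)!) := by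
    rw [Nat.cast_choose ℚ (by omega)]
    congr 4
    omega
  have f1 := hfac (j + m)
  have f2 := hfac j
  have f3 := hfac m
  have p1 : (j : ℚ) + m + 1 ≠ 0 := by positivity
  have p2 : (j : ℚ) + m + 2 ≠ 0 := by positivity
  have p3 : (j : ℚ) + 1 ≠ 0 := by positivity
  have q1 : (j : ℚ) + 1 + m + 0 = j + m + 1 := by ring
  have q2 : (j : ℚ) + m + 1 + 1 = j + m + 2 := by ring
  have key : (((j + 1 + m)! * c : ℕ) : ℚ) =
      (((j + m)! * (j + 1 + m).choose (j + 1) * (j + 1 + m + (j + 1)).choose j : ℕ) : ℚ) := by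
    push_cast
    rw [h1, h2, hf, e2, Nat.factorial_succ (j + m + 1), Nat.factorial_succ (j + m)]
    unfold codeFormula
    rw [add_zero (j + 1), add_zero (j + 1 + m), Nat.factorial_succ j, e2]
    push_cast
    rw [q1, q2]
    field_simp
    ring
  exact_mod_cast key

/-! ### Codes as order types of increasing sequences with their shifts by 2. -/

/-- The code `l` records, for the increasing sequence `b` of the same length as `l`, the position
of every `b j` relative to the numbers `b i + 2` with `i ≤ j`. -/
def Realizes (b : ℕ → ℝ) : List (ℕ × Bool) → Prop
  | [] => True
  | c :: l => Realizes b l ∧ (∀ i < l.length, b i < b l.length) ∧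
      (∀ i ≤ l.length, (b l.length < b i + 2 ↔ c.1 ≤ i)) ∧
      ∀ i ≤ l.length, (b l.length = b i + 2 ↔ c.2 = true ∧ i + 1 = c.1)

theorem Realizes.congr {b b' : ℕ → ℝ} {l : List (ℕ × Bool)} (h : Realizes b l)
    (hb : ∀ i < l.length, b i = b' i) : Realizes b' l := by
  induction l with
  | nil => trivial
  | cons c l ih =>
    obtain ⟨h1, h2, h3, h4⟩ := h
    have hl : b l.length = b' l.length := hb _ (by simp)
    have hi : ∀ i ≤ l.length, b i = b' i := fun i hi => hb i (by simpa using Nat.lt_succ_of_le hi)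
    refine ⟨ih h1 fun i h => hi i h.le, fun i h => ?_, fun i h => ?_, fun i h => ?_⟩
    · rw [← hl, ← hi i h.le]; exact h2 i h
    · rw [← hl, ← hi i h]; exact h3 i h
    · rw [← hl, ← hi i h]; exact h4 i h

theorem Realizes.strictMonoOn {b : ℕ → ℝ} {l : List (ℕ × Bool)} (h : Realizes b l) :
    StrictMonoOn b (Set.Iio l.length) := by
  induction l with
  | nil => intro i hi; simp at hi
  | cons c l ih =>
    obtain ⟨h1, h2, -⟩ := h
    intro i hi j hj hij
    simp only [List.length_cons, Set.mem_Iio] at hi hj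
    rcases (Nat.lt_succ_iff.1 hj).lt_or_eq with hj' | rfl
    · exact ih h1 (hij.trans hj') hj' hij
    · exact h2 i hij

theorem Realizes.lt_add_two_iff {b : ℕ → ℝ} {l : List (ℕ × Bool)} (h : Realizes b l)
    {n i : ℕ} (hn : l.length = n + 1) (hi : i ≤ n) : b n < b i + 2 ↔ codeTop l ≤ i := by
  rcases l with _ | ⟨c, l⟩
  · simp at hn
  · obtain rfl : l.length = n := by simpa using hn
    exact h.2.2.1 i hi

/-- The sequences `b` and `b'` have the same order relations among their first `n` terms and
their shifts by `2`. -/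
def SameShiftOrder (n : ℕ) (b b' : ℕ → ℝ) : Prop :=
  ∀ i < n, ∀ j < n, (b i < b j ↔ b' i < b' j) ∧ (b i + 2 < b j ↔ b' i + 2 < b' j) ∧
    (b i < b j + 2 ↔ b' i < b' j + 2)

theorem Realizes.sameShiftOrder {b b' : ℕ → ℝ} {l : List (ℕ × Bool)} (h : Realizes b l)
    (h' : Realizes b' l) : SameShiftOrder l.length b b' := by
  induction l with
  | nil => intro i hi; simp at hi
  | cons c l ih =>
    obtain ⟨h1, h2, h3, h4⟩ := h
    obtain ⟨h1', h2', h3', h4'⟩ := h'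
    have key : ∀ i ≤ l.length, (b l.length < b i + 2 ↔ b' l.length < b' i + 2) ∧
        (b i + 2 < b l.length ↔ b' i + 2 < b' l.length) := by
      intro i hi
      have e1 := (h3 i hi).trans (h3' i hi).symm
      have e2 := (h4 i hi).trans (h4' i hi).symm
      refine ⟨e1, ?_⟩
      have : ∀ x y : ℝ, x < y ↔ ¬ (y < x) ∧ ¬ (y = x) := fun x y =>
        ⟨fun h => ⟨h.not_gt, h.ne'⟩, fun h => lt_of_le_of_ne (not_lt.1 h.1) (Ne.symm h.2)⟩
      rw [this, this (b' i + 2), e1, e2]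
    intro i hi j hj
    simp only [List.length_cons] at hi hj
    rcases (Nat.lt_succ_iff.1 hi).lt_or_eq with hi' | rfl <;>
      rcases (Nat.lt_succ_iff.1 hj).lt_or_eq with hj' | rfl
    · exact ih h1 h1' i hi' j hj'
    · have u := h2 i hi'
      have u' := h2' i hi'
      refine ⟨by simp [u, u'], (key i hi'.le).2, ?_⟩
      have : b i < b l.length + 2 := by linarith
      have : b' i < b' l.length + 2 := by linarith
      simp [*]
    · have u := h2 j hj'
      have u' := h2' j hj'
      refine ⟨by simp [u.not_gt, u'.not_gt], ?_, (key j hj'.le).1⟩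
      have : ¬ b l.length + 2 < b j := by linarith
      have : ¬ b' l.length + 2 < b' j := by linarith
      simp [*]
    · simp

/-- The first component of the head is the least index whose shift exceeds the last term. A mark
shows as an equality at the preceding index, which exists because a marked entry is positive. -/
theorem code_unique {b b' : ℕ → ℝ} {l l' : List (ℕ × Bool)} (hv : ValidCode l)
    (hv' : ValidCode l') (h : Realizes b l) (h' : Realizes b' l') (hlen : l.length = l'.length)
    (hb : SameShiftOrder l.length b b') : l = l' := by
  induction l generalizing l' with
  | nil => exact (List.length_eq_zero_iff.1 hlen.symm).symm
  | cons c l ih =>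
    rcases l' with _ | ⟨c', l'⟩
    · simp at hlen
    simp only [List.length_cons, Nat.add_right_cancel_iff] at hlen
    simp only [List.length_cons] at hb
    obtain ⟨h1, -, h3, h4⟩ := h
    obtain ⟨h1', -, h3', h4'⟩ := h'
    obtain rfl : l = l' := ih hv.1 hv'.1 h1 h1' hlen fun i hi j hj =>
      hb i (by omega) j (by omega)
    have e1 : ∀ i ≤ l.length, (c.1 ≤ i ↔ c'.1 ≤ i) := fun i hi => by
      rw [← h3 i hi, ← h3' i hi]
      exact (hb l.length (by omega) i (by omega)).2.2
    have e2 : ∀ i ≤ l.length, (c.2 = true ∧ i + 1 = c.1 ↔ c'.2 = true ∧ i + 1 = c'.1) := by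
      intro i hi
      rw [← h4 i hi, ← h4' i hi, eq_iff_le_not_lt, eq_iff_le_not_lt, ← not_lt, ← not_lt,
        (hb i (by omega) l.length (by omega)).2.1, (hb l.length (by omega) i (by omega)).2.2]
    have hc : c.1 = c'.1 := le_antisymm ((e1 _ hv'.2.1).2 le_rfl) ((e1 _ hv.2.1).1 le_rfl)
    have hc2 : c.2 = true ↔ c'.2 = true := by
      constructor
      · intro ht
        have := hv.2.2.2 ht
        have hle := hv.2.1
        exact ((e2 (c.1 - 1) (by omega)).1 ⟨ht, by omega⟩).1
      · intro ht
        have := hv'.2.2.2 ht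
        have hle := hv'.2.1
        exact ((e2 (c'.1 - 1) (by omega)).2 ⟨ht, by omega⟩).1
    rw [Prod.ext hc (Bool.eq_iff_iff.2 hc2)]

theorem ValidCode.codeTop_le_length {l : List (ℕ × Bool)} (h : ValidCode l) :
    codeTop l ≤ l.length := by
  rcases l with _ | ⟨c, l⟩
  · exact le_rfl
  · exact h.2.1.trans (by simp)

theorem exists_code (b : ℕ → ℝ) (n : ℕ) (hb : StrictMonoOn b (Set.Iio n)) :
    ∃ l, ValidCode l ∧ l.length = n ∧ Realizes b l := by
  classical
  induction n with
  | zero => exact ⟨[], trivial, rfl, trivial⟩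
  | succ n ih =>
    obtain ⟨l, hv, rfl, hr⟩ := ih (hb.mono (Set.Iio_subset_Iio n.le_succ))
    have hmono : ∀ i j, i < j → j ≤ l.length → b i < b j := fun i j hij hj =>
      hb (Set.mem_Iio.2 (by omega)) (Set.mem_Iio.2 (by omega)) hij
    have hex : ∃ i, b l.length < b i + 2 := ⟨l.length, by linarith⟩
    let q := Nat.find hex
    have hq : b l.length < b q + 2 := Nat.find_spec hex
    have hqn : q ≤ l.length := Nat.find_min' hex (by linarith)
    have hlt : ∀ i ≤ l.length, (b l.length < b i + 2 ↔ q ≤ i) := by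
      intro i hi
      refine ⟨fun h => Nat.find_min' hex h, fun h => ?_⟩
      rcases h.lt_or_eq with h | h
      · linarith [hmono _ _ h hi]
      · rwa [← h]
    have heq : ∀ i ≤ l.length, b l.length = b i + 2 → i + 1 = q := by
      intro i hi h
      have h1 : i < q := by
        by_contra h1
        have := (hlt i hi).2 (not_lt.1 h1)
        linarith
      have h2 := (hlt (i + 1) (by omega)).1 (by linarith [hmono i (i + 1) (by omega) (by omega)])
      omega
    -- The preceding term is strictly below `b i + 2`. In the case of equality `i = q - 1`, so a
    -- mark comes with a strict ascent.
    have htop : ∀ i, b l.length ≤ b i + 2 → i < l.length → codeTop l ≤ i := by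
      intro i h hi
      obtain ⟨m, hm⟩ := Nat.exists_eq_succ_of_ne_zero (Nat.ne_zero_of_lt hi)
      refine (hr.lt_add_two_iff hm (by omega)).1 ?_
      linarith [hmono m l.length (by omega) le_rfl]
    refine ⟨(q, decide (∃ i ≤ l.length, b l.length = b i + 2)) :: l, ⟨hv, hqn, ?_, ?_⟩, rfl,
      ⟨hr, fun i hi => hmono i _ hi le_rfl, hlt, fun i hi => ?_⟩⟩
    · change codeTop l ≤ q
      rcases hqn.lt_or_eq with h | h
      · exact htop q hq.le h
      · rw [h]; exact hv.codeTop_le_length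
    · intro ht
      obtain ⟨i, hi, h⟩ := of_decide_eq_true ht
      have := heq i hi h
      have := htop i h.le (by omega)
      change codeTop l < q
      omega
    · simp only [decide_eq_true_eq]
      refine ⟨fun h => ⟨⟨i, hi, h⟩, heq i hi h⟩, ?_⟩
      rintro ⟨⟨j, hj, h⟩, hiq⟩
      have := heq j hj h
      obtain rfl : i = j := by omega
      exact h

theorem exists_next_term {b : ℕ → ℝ} {c : ℕ × Bool} {l : List (ℕ × Bool)}
    (hv : ValidCode (c :: l)) (hr : Realizes b l) :
    ∃ x, ∀ i < l.length, b i < x ∧ (x < b i + 2 ↔ c.1 ≤ i) ∧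
      (x = b i + 2 ↔ c.2 = true ∧ i + 1 = c.1) := by
  obtain ⟨hvl, hq, htop, htie⟩ := hv
  obtain ⟨q, t⟩ := c
  simp only at hq htop htie ⊢
  rcases Nat.eq_zero_or_pos l.length with h0 | h0
  · exact ⟨0, fun i hi => by omega⟩
  obtain ⟨n, hn⟩ := Nat.exists_eq_succ_of_ne_zero h0.ne'
  have hmono := hr.strictMonoOn
  have hlt : ∀ i < l.length, ∀ j < l.length, (b i < b j ↔ i < j) := fun i hi j hj =>
    hmono.lt_iff_lt hi hj
  have hinj : ∀ i < l.length, ∀ j < l.length, (b i = b j ↔ i = j) := fun i hi j hj =>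
    hmono.injOn.eq_iff hi hj
  have hlast : ∀ i < l.length, b i ≤ b n := fun i hi =>
    hmono.monotoneOn hi (Set.mem_Iio.2 (by omega)) (by omega)
  have hbn : ∀ i ≤ n, codeTop l ≤ i → b n < b i + 2 := fun i hi h =>
    (hr.lt_add_two_iff hn hi).2 h
  rcases t
  · simp only [Bool.false_eq_true, false_and, iff_false]
    rcases hq.lt_or_eq with hq' | hq'
    -- The new term must lie strictly between `max (b n) (b (q - 1) + 2)` and `b q + 2`; validity of
    -- the code makes this interval nonempty.
    · obtain ⟨lo, h1, h2, h3⟩ : ∃ lo, b n ≤ lo ∧ (∀ i < q, b i + 2 ≤ lo) ∧ lo < b q + 2 := by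
        rcases q with _ | q
        · exact ⟨b n, le_rfl, fun i hi => by omega, hbn _ (by omega) htop⟩
        · refine ⟨max (b n) (b q + 2), le_max_left _ _, fun i hi => ?_, ?_⟩
          · refine le_trans ?_ (le_max_right _ _)
            have := hmono.monotoneOn (Set.mem_Iio.2 (by omega : i < l.length))
              (Set.mem_Iio.2 (by omega : q < l.length)) (by omega)
            linarith
          · refine max_lt (hbn _ (by omega) htop) ?_
            have := (hlt q (by omega) (q + 1) hq').2 (by omega)
            linarith
      obtain ⟨x, hx1, hx2⟩ := exists_between h3
      refine ⟨x, fun i hi => ⟨(hlast i hi).trans_lt (h1.trans_lt hx1), ?_, ?_⟩⟩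
      · constructor
        · intro h
          by_contra hlt'
          linarith [h2 i (not_le.1 hlt')]
        · intro h
          have := hmono.monotoneOn (Set.mem_Iio.2 hq') (Set.mem_Iio.2 hi) h
          linarith
      · rcases lt_or_ge i q with h | h
        · have := h2 i h
          intro h'
          linarith
        · have := hmono.monotoneOn (Set.mem_Iio.2 hq') (Set.mem_Iio.2 hi) h
          intro h'
          linarith
    -- Here the new term must exceed all earlier shifts by 2.
    · refine ⟨b n + 3, fun i hi => ?_⟩
      have := hlast i hi
      refine ⟨by linarith, ⟨fun h => by linarith, fun h => by omega⟩, fun h => by linarith⟩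
  · have htie := htie rfl
    obtain ⟨p, rfl⟩ := Nat.exists_eq_succ_of_ne_zero (Nat.ne_zero_of_lt htie)
    have hp : p < l.length := by omega
    refine ⟨b p + 2, fun i hi => ⟨(hlast i hi).trans_lt (hbn p (by omega) (by omega)), ?_, ?_⟩⟩
    · rw [add_lt_add_iff_right, hlt p hp i hi, Nat.succ_le_iff]
    · rw [add_left_inj, hinj p hp i hi]
      constructor
      · rintro rfl; exact ⟨rfl, rfl⟩
      · rintro ⟨-, h⟩; omega

theorem ValidCode.exists_realizes {l : List (ℕ × Bool)} (hv : ValidCode l) :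
    ∃ b, Realizes b l := by
  induction l with
  | nil => exact ⟨0, trivial⟩
  | cons c l ih =>
    obtain ⟨b, hb⟩ := ih hv.1
    obtain ⟨x, hx⟩ := exists_next_term hv hb
    have hu : ∀ i < l.length, Function.update b l.length x i = b i := fun i hi =>
      Function.update_of_ne hi.ne _ _
    refine ⟨Function.update b l.length x, hb.congr fun i hi => (hu i hi).symm,
      fun i hi => ?_, fun i hi => ?_, fun i hi => ?_⟩
    · rw [hu i hi, Function.update_self]; exact (hx i hi).1
    · rcases hi.lt_or_eq with hi | rfl
      · rw [hu i hi, Function.update_self]; exact (hx i hi).2.1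
      · simp [hv.2.1]
    · rcases hi.lt_or_eq with hi | rfl
      · rw [hu i hi, Function.update_self]; exact (hx i hi).2.2
      · have := hv.2.1
        refine ⟨fun h => by linarith, fun h => by omega⟩

/-- The chains of terms with successive differences `2` are the fibers of a map onto
`{0, …, k - 1}`, where `k` is the length of the code minus its number of marks. -/
theorem Realizes.exists_root {b : ℕ → ℝ} {l : List (ℕ × Bool)} (hv : ValidCode l)
    (hr : Realizes b l) : ∃ (k : ℕ) (root : ℕ → ℕ), k + tieCount l = l.length ∧
      (∀ i < l.length, root i < k) ∧ (∀ m < k, ∃ i < l.length, root i = m) ∧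
      (∀ i < l.length, ∀ j < l.length, b i = b j + 2 → root i = root j) ∧
      ∀ w : ℕ → ℝ, (∀ i < l.length, ∀ j < l.length, b i = b j + 2 → w i = w j) →
        ∀ i < l.length, ∀ j < l.length, root i = root j → w i = w j := by
  induction l with
  | nil => exact ⟨0, id, rfl, by simp, by simp, by simp, by simp⟩
  | cons c l ih =>
    obtain ⟨k, root, hk, h1, h2, h3, h4⟩ := ih hv.1 hr.1
    obtain ⟨-, hlt, -, heq⟩ := hr
    have hlast : ∀ j ≤ l.length, b j ≠ b l.length + 2 := by
      intro j hj
      rcases hj.lt_or_eq with hj | rfl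
      · linarith [hlt j hj]
      · linarith
    simp only [List.length_cons, Nat.lt_succ_iff, tieCount_cons]
    have hle : ∀ {p : ℕ → Prop}, (∀ i < l.length, p i) → p l.length → ∀ i ≤ l.length, p i :=
      fun hp hp' i hi => hi.lt_or_eq.elim (hp i) fun h => h ▸ hp'
    obtain ⟨q, t⟩ := c
    have hu : ∀ y, ∀ i < l.length, Function.update root l.length y i = root i := fun y i hi =>
      Function.update_of_ne hi.ne _ _
    -- An unmarked term starts a new chain with label `k`; a marked term joins the chain of the
    -- unique earlier term lying 2 below it.
    rcases t
    · have hne : ∀ i ≤ l.length, b l.length ≠ b i + 2 := fun i hi h => by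
        simpa using ((heq i hi).1 h).1
      refine ⟨k + 1, Function.update root l.length k, by simp; omega, ?_, ?_, ?_, ?_⟩
      · exact hle (fun i hi => by rw [hu k i hi]; exact (h1 i hi).trans (Nat.lt_succ_self k))
          (by simp)
      · intro m hm
        rcases (Nat.lt_succ_iff.1 hm).lt_or_eq with hm | rfl
        · obtain ⟨i, hi, rfl⟩ := h2 m hm
          exact ⟨i, hi.le, hu k i hi⟩
        · exact ⟨l.length, le_rfl, Function.update_self _ _ _⟩
      · refine hle (fun i hi => hle (fun j hj h => ?_) fun h => absurd h (hlast i hi.le))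
          fun j hj h => absurd h (hne j hj)
        rw [hu k i hi, hu k j hj]
        exact h3 i hi j hj h
      · intro w hw
        have hw' := h4 w fun i hi j hj => hw i hi.le j hj.le
        refine hle (fun i hi => hle (fun j hj h => ?_) fun h => ?_) (hle (fun j hj h => ?_)
          fun _ => rfl)
        · rw [hu k i hi, hu k j hj] at h
          exact hw' i hi j hj h
        · rw [hu k i hi, Function.update_self] at h
          exact absurd h (h1 i hi).ne
        · rw [hu k j hj, Function.update_self] at h
          exact absurd h (h1 j hj).ne'
    · have htop := hv.2.2.2 rfl
      have hql := hv.2.1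
      simp only at htop hql
      obtain ⟨p, rfl⟩ := Nat.exists_eq_succ_of_ne_zero (Nat.ne_zero_of_lt htop)
      have hp : p < l.length := by omega
      have hbp : b l.length = b p + 2 := (heq p hp.le).2 ⟨rfl, rfl⟩
      have huniq : ∀ j ≤ l.length, b l.length = b j + 2 → j = p := fun j hj h => by
        simpa using ((heq j hj).1 h).2
      refine ⟨k, Function.update root l.length (root p), by simp; omega, ?_, ?_, ?_, ?_⟩
      · exact hle (fun i hi => by rw [hu _ i hi]; exact h1 i hi)
          (by rw [Function.update_self]; exact h1 p hp)
      · intro m hm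
        obtain ⟨i, hi, rfl⟩ := h2 m hm
        exact ⟨i, hi.le, hu _ i hi⟩
      · refine hle (fun i hi => hle (fun j hj h => ?_) fun h => absurd h (hlast i hi.le))
          fun j hj h => ?_
        · rw [hu _ i hi, hu _ j hj]
          exact h3 i hi j hj h
        · rw [huniq j hj h, Function.update_self, hu _ p hp]
      · intro w hw
        have hw' := h4 w fun i hi j hj => hw i hi.le j hj.le
        have hwp : w l.length = w p := hw _ le_rfl p hp.le hbp
        refine hle (fun i hi => hle (fun j hj h => ?_) fun h => ?_) (hle (fun j hj h => ?_)
          fun _ => rfl)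
        · rw [hu _ i hi, hu _ j hj] at h
          exact hw' i hi j hj h
        · rw [hu _ i hi, Function.update_self] at h
          rw [hwp]
          exact hw' i hi p hp h
        · rw [hu _ j hj, Function.update_self] at h
          rw [hwp]
          exact hw' p hp j hj h

/-! ### From slope orders to labelled codes. -/

theorem sameSlopeOrder_iff {d : ℕ} {a a' : Fin d → ℝ} :
    SameSlopeOrder a a' ↔ ∀ i j, (a i < a j ↔ a' i < a' j) ∧ (a i + 2 < a j ↔ a' i + 2 < a' j) ∧
      (a i < a j + 2 ↔ a' i < a' j + 2) := by
  have e1 : ∀ (c : Fin d → ℝ) (i j : Fin d) (x : Bool),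
      pileSlope c (i, x) < pileSlope c (j, x) ↔ c i < c j := fun c i j x => by
    simp [pileSlope]
  have e2 : ∀ (c : Fin d → ℝ) (i j : Fin d),
      pileSlope c (i, true) < pileSlope c (j, false) ↔ c i + 2 < c j := fun c i j => by
    simp only [pileSlope, cond_true, cond_false]
    constructor <;> intro h <;> linarith
  have e3 : ∀ (c : Fin d → ℝ) (i j : Fin d),
      pileSlope c (i, false) < pileSlope c (j, true) ↔ c i < c j + 2 := fun c i j => by
    simp only [pileSlope, cond_true, cond_false]
    constructor <;> intro h <;> linarith
  constructor
  · intro h i j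
    rw [← e1 a i j true, ← e1 a' i j true, ← e2, ← e2, ← e3, ← e3]
    exact ⟨h _ _, h _ _, h _ _⟩
  · rintro h ⟨i, _ | _⟩ ⟨j, _ | _⟩
    · rw [e1, e1]; exact (h i j).1
    · rw [e3, e3]; exact (h i j).2.2
    · rw [e2, e2]; exact (h i j).2.1
    · rw [e1, e1]; exact (h i j).1

theorem exists_strictMonoOn_comp {d : ℕ} (a : Fin d → ℝ) :
    ∃ (r : ℕ) (f : Fin d → ℕ) (b : ℕ → ℝ), r ≤ d ∧ Finset.univ.image f = Finset.range r ∧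
      StrictMonoOn b (Set.Iio r) ∧ a = fun i => b (f i) := by
  let S := Finset.univ.image a
  let e := S.orderIsoOfFin rfl
  have ha : ∀ i, a i ∈ S := fun i => Finset.mem_image_of_mem a (Finset.mem_univ i)
  refine ⟨S.card, fun i => e.symm ⟨a i, ha i⟩, fun n => if h : n < S.card then e ⟨n, h⟩ else 0,
    Finset.card_image_le.trans (by simp), ?_, ?_, ?_⟩
  · ext n
    rw [Finset.mem_image, Finset.mem_range]
    constructor
    · rintro ⟨i, -, rfl⟩
      exact Fin.is_lt _
    · intro hn
      obtain ⟨i, -, hi⟩ := Finset.mem_image.1 (e ⟨n, hn⟩).2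
      refine ⟨i, Finset.mem_univ i, ?_⟩
      have : (⟨a i, ha i⟩ : S) = e ⟨n, hn⟩ := Subtype.ext hi
      rw [this, OrderIso.symm_apply_apply]
  · intro m hm n hn hmn
    have hm' : m < S.card := hm
    have hn' : n < S.card := hn
    simp only [hm', hn', dif_pos]
    exact e.strictMono (Fin.mk_lt_mk.2 hmn)
  · ext i
    simp

/-- All values below `f i` are attained by `f`, and `f'` maps this chain to a strictly increasing
one. Used in both directions, this recovers `f` from the order it induces. -/
theorem le_of_lt_imp_lt {d r : ℕ} {f f' : Fin d → ℕ} (hf : Finset.univ.image f = Finset.range r)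
    (h : ∀ i j, f i < f j → f' i < f' j) (i : Fin d) : f i ≤ f' i := by
  have key : ∀ n i, n ≤ f i → n ≤ f' i := by
    intro n
    induction n with
    | zero => exact fun _ _ => Nat.zero_le _
    | succ n ih =>
      intro i hi
      have hir : f i ∈ Finset.range r := hf ▸ Finset.mem_image_of_mem f (Finset.mem_univ i)
      have hn : n ∈ Finset.univ.image f := by
        rw [hf, Finset.mem_range]
        exact lt_trans hi (Finset.mem_range.1 hir)
      obtain ⟨j, -, rfl⟩ := Finset.mem_image.1 hn
      exact (ih j le_rfl).trans_lt (h j i hi)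
  exact key _ i le_rfl

/-- Pulling back along `root ∘ f` identifies the tie space with the functions on the `k` chains. -/
theorem finrank_tieSpace {d r : ℕ} (hd : 0 < d) {f : Fin d → ℕ}
    (hf : Finset.univ.image f = Finset.range r) {b : ℕ → ℝ} {l : List (ℕ × Bool)} (hv : ValidCode l) (hr : Realizes b l)
    (hlen : l.length = r) :
    Module.finrank ℝ (tieSpace fun i => b (f i)) + tieCount l = r := by
  obtain ⟨k, root, hk, h1, h2, h3, h4⟩ := hr.exists_root hv
  rw [hlen] at hk h1 h2 h3 h4
  have hfr : ∀ i, f i < r := fun i =>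
    Finset.mem_range.1 (hf ▸ Finset.mem_image_of_mem f (Finset.mem_univ i))
  have hsurj : ∀ n < r, ∃ i, f i = n := fun n hn => by
    have : n ∈ Finset.univ.image f := by rw [hf]; exact Finset.mem_range.2 hn
    simpa using this
  have : Nonempty (Fin d) := ⟨⟨0, hd⟩⟩
  choose! g hg using hsurj
  have hinj : Set.InjOn b (Set.Iio r) := hlen ▸ hr.strictMonoOn.injOn
  let Φ : (Fin k → ℝ) →ₗ[ℝ] (Fin d → ℝ) :=
    LinearMap.funLeft ℝ ℝ fun i => ⟨root (f i), h1 _ (hfr i)⟩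
  have hΦinj : Function.Injective Φ := by
    refine LinearMap.funLeft_injective_of_surjective ℝ ℝ _ ?_
    rintro ⟨m, hm⟩
    obtain ⟨n, hn, rfl⟩ := h2 m hm
    exact ⟨g n, Fin.ext (congrArg root (hg n hn))⟩
  have hrange : LinearMap.range Φ = tieSpace fun i => b (f i) := by
    ext v
    constructor
    · rintro ⟨u, rfl⟩ ⟨i, x⟩ ⟨j, y⟩ hij
      refine congrArg u (Fin.ext ?_)
      change root (f i) = root (f j)
      simp only [pileSlope] at hij
      rcases x <;> rcases y <;> simp only [cond_true, cond_false] at hij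
      · exact congrArg root (hinj (hfr i) (hfr j) (by linarith))
      · exact h3 _ (hfr i) _ (hfr j) (by linarith)
      · exact (h3 _ (hfr j) _ (hfr i) (by linarith)).symm
      · exact congrArg root (hinj (hfr i) (hfr j) (by linarith))
    · intro hv'
      have hv1 : ∀ i j, f i = f j → v i = v j := fun i j hij =>
        hv' (i, true) (j, true) (by simp [pileSlope, hij])
      have hv2 : ∀ i j, b (f i) = b (f j) + 2 → v i = v j := fun i j hij =>
        hv' (i, false) (j, true) (by simp only [pileSlope, cond_true, cond_false]; linarith)
      have hw := h4 (fun n => v (g n)) fun m hm n hn hmn =>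
        hv2 _ _ (by rw [hg m hm, hg n hn]; exact hmn)
      choose! s hs hs' using h2
      refine ⟨fun m => v (g (s m)), funext fun i => ?_⟩
      have hi := h1 _ (hfr i)
      change v (g (s (root (f i)))) = v i
      rw [hw _ (hs _ hi) _ (hfr i) (hs' _ hi)]
      exact hv1 _ _ (hg _ (hfr i))
  rw [← hrange, LinearMap.finrank_range_of_inj hΦinj, Module.finrank_fin_fun, hk]

/-! ### Labelled codes biject with the lower faces. -/

/-- The labelled codes: a map onto `{0, …, r - 1}` together with a valid code of length `r` with
`r - k` marks. -/
def labelledCodes (d k r : ℕ) : Set ((Fin d → ℕ) × List (ℕ × Bool)) :=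
  (mapsOnto d (Finset.range r) : Set (Fin d → ℕ)) ×ˢ codeSet r r (r - k)

theorem encard_labelledCodes {d k r : ℕ} (hk : 1 ≤ k) (hkr : k ≤ r) :
    (labelledCodes d k r).encard =
      (((r - 1)! * Nat.stirlingSecond d r * r.choose k * (r + k).choose (k - 1) : ℕ) : ℕ∞) := by
  obtain ⟨c, hc, hmul⟩ := encard_codeSet_self hk hkr
  rw [labelledCodes, Set.encard_prod, Set.encard_coe_eq_coe_finsetCard, hc, card_mapsOnto,
    Finset.card_range, ← Nat.cast_mul, mul_right_comm, hmul]
  congr 1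
  ring

theorem encard_iUnion_labelledCodes {d k : ℕ} (hk : 1 ≤ k) :
    (⋃ r ∈ (Finset.Icc k d : Set ℕ), labelledCodes d k r).encard =
      ((∑ r ∈ Finset.Icc k d,
        (r - 1)! * Nat.stirlingSecond d r * r.choose k * (r + k).choose (k - 1) : ℕ) : ℕ∞) := by
  rw [(Finset.finite_toSet _).encard_biUnion, finsum_mem_coe_finset, Nat.cast_sum]
  · exact Finset.sum_congr rfl fun r hr => encard_labelledCodes hk (Finset.mem_Icc.1 hr).1
  · intro r _ r' _ hne
    rw [Function.onFun, Set.disjoint_left]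
    rintro ⟨f, l⟩ ⟨-, -, h, -⟩ ⟨-, -, h', -⟩
    exact hne (h.symm.trans h')

open Classical in
/-- An increasing sequence realizing a valid code. -/
noncomputable def realization (l : List (ℕ × Bool)) : ℕ → ℝ :=
  if h : ValidCode l then h.exists_realizes.choose else 0

theorem ValidCode.realizes_realization {l : List (ℕ × Bool)} (h : ValidCode l) :
    Realizes (realization l) l := by
  rw [realization, dif_pos h]
  exact h.exists_realizes.choose_spec

/-- The lower face of the path polytope with a given labelled code. -/
noncomputable def codeFace {d : ℕ} (x : (Fin d → ℕ) × List (ℕ × Bool)) :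
    Set ((Fin d → ℝ) × ℝ) :=
  pileFace fun i => realization x.2 (x.1 i)

theorem pileFace_comp_eq {d r : ℕ} (hd : 0 < d) {f : Fin d → ℕ}
    (hf : Finset.univ.image f = Finset.range r) {b b' : ℕ → ℝ} (h : SameShiftOrder r b b') :
    pileFace (fun i => b (f i)) = pileFace fun i => b' (f i) := by
  have hfr : ∀ i, f i < r := fun i =>
    Finset.mem_range.1 (hf ▸ Finset.mem_image_of_mem f (Finset.mem_univ i))
  exact (pileFace_eq_iff hd).2 (sameSlopeOrder_iff.2 fun i j => h _ (hfr i) _ (hfr j))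

/-- The face determines the slope order, which determines first the labelling `f`, hence `r`, and
then the code by `code_unique`. -/
theorem codeFace_injOn {d k : ℕ} (hd : 0 < d) :
    Set.InjOn codeFace (⋃ r ∈ (Finset.Icc k d : Set ℕ), labelledCodes d k r) := by
  rintro ⟨f, l⟩ hx ⟨f', l'⟩ hx' heq
  simp only [Set.mem_iUnion] at hx hx'
  obtain ⟨r, -, hf, hv, hlen, -, -⟩ := hx
  obtain ⟨r', -, hf', hv', hlen', -, -⟩ := hx'
  simp only [Finset.mem_coe, mem_mapsOnto] at hf hf' hv hv' hlen hlen'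
  have hr := hv.realizes_realization
  have hr' := hv'.realizes_realization
  have hord := sameSlopeOrder_iff.1 ((pileFace_eq_iff hd).1 heq)
  have hfr : ∀ i, f i < r := fun i =>
    Finset.mem_range.1 (hf ▸ Finset.mem_image_of_mem f (Finset.mem_univ i))
  have hfr' : ∀ i, f' i < r' := fun i =>
    Finset.mem_range.1 (hf' ▸ Finset.mem_image_of_mem f' (Finset.mem_univ i))
  have hlt : ∀ i j, f i < f j ↔ f' i < f' j := fun i j => by
    have h1 := (hlen ▸ hr.strictMonoOn).lt_iff_lt (hfr i) (hfr j)
    have h2 := (hlen' ▸ hr'.strictMonoOn).lt_iff_lt (hfr' i) (hfr' j)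
    rw [← h1, ← h2]
    exact (hord i j).1
  obtain rfl : f = f' := funext fun i =>
    (le_of_lt_imp_lt hf (fun i j => (hlt i j).1) i).antisymm
      (le_of_lt_imp_lt hf' (fun i j => (hlt i j).2) i)
  obtain rfl : r = r' := by
    simpa using congrArg Finset.card (hf.symm.trans hf')
  have hsurj : ∀ n < r, ∃ i, f i = n := fun n hn => by
    have : n ∈ Finset.univ.image f := by rw [hf]; exact Finset.mem_range.2 hn
    simpa using this
  rw [code_unique hv hv' hr hr' (hlen.trans hlen'.symm)]
  intro m hm n hn
  obtain ⟨i, rfl⟩ := hsurj m (hlen ▸ hm)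
  obtain ⟨j, rfl⟩ := hsurj n (hlen ▸ hn)
  exact hord i j

theorem codeFace_image {d k : ℕ} (hk : 1 ≤ k) (hkd : k ≤ d) :
    codeFace '' (⋃ r ∈ (Finset.Icc k d : Set ℕ), labelledCodes d k r) =
      {F : Set ((Fin d → ℝ) × ℝ) |
        IsLowerFace (pilePathPolytope (fun _ : Fin d => 2)) F ∧ faceDim F = d - k} := by
  have hd : 0 < d := hk.trans hkd
  ext F
  constructor
  · rintro ⟨⟨f, l⟩, hx, rfl⟩
    simp only [Set.mem_iUnion] at hx
    obtain ⟨r, hr, hf, hv, hlen, -, hties⟩ := hx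
    simp only [Finset.mem_coe, mem_mapsOnto] at hr hf hv hlen hties
    rw [Finset.mem_Icc] at hr
    refine ⟨isLowerFace_iff.2 ⟨_, rfl⟩, ?_⟩
    have h1 := finrank_tieSpace hd hf hv hv.realizes_realization hlen
    have h2 := faceDim_pileFace_add_finrank_tieSpace hd fun i => realization l (f i)
    change faceDim (pileFace fun i => realization l (f i)) = d - k
    omega
  · rintro ⟨hF, hdim⟩
    obtain ⟨a, rfl⟩ := isLowerFace_iff.1 hF
    obtain ⟨r, f, b, hrd, hf, hb, rfl⟩ := exists_strictMonoOn_comp a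
    obtain ⟨l, hv, hlen, hr⟩ := exists_code b r hb
    have h1 := finrank_tieSpace hd hf hv hr hlen
    have h2 := faceDim_pileFace_add_finrank_tieSpace hd fun i => b (f i)
    refine ⟨(f, l), ?_, pileFace_comp_eq hd hf (hlen ▸ hv.realizes_realization.sameShiftOrder hr)⟩
    simp only [Set.mem_iUnion]
    refine ⟨r, ?_, mem_mapsOnto.2 hf, hv, hlen, hlen ▸ hv.codeTop_le_length, ?_⟩
    -- Since `k ≤ d`, the dimension `d - k` is not truncated, so the tie space has dimension `k`;
    -- thus `k ≤ r` and there are `r - k` marks.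
    · rw [Finset.mem_coe, Finset.mem_Icc]
      omega
    · simp only
      omega

theorem corollary4p4 (d k : ℕ) (hk : 1 ≤ k) (hkd : k ≤ d) :
    {F : Set ((Fin d → ℝ) × ℝ) |
        IsLowerFace (pilePathPolytope (fun _ : Fin d => 2)) F ∧ faceDim F = d - k}.encard =
      ((∑ r ∈ Finset.Icc k d,
        (r - 1)! * Nat.stirlingSecond d r * r.choose k * (r + k).choose (k - 1) : ℕ) : ℕ∞) := by
  rw [← codeFace_image hk hkd, (codeFace_injOn (hk.trans hkd)).encard_image,
    encard_iUnion_labelledCodes hk]
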